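/- Let $d\ge 1$, let $p,q,r\in[2,\infty)$, and let $\eta\in C_c^\infty(\mathbb R^d)$ be a radial function with $\eta(\xi)=1$ for $1/4\le|\xi|\le 12$. For $\lambda>0$ and $t\in\mathbb R$ let $e^{it\Delta}\eta(\tfrac D\lambda)$ be the convolution operator with Fourier multiplier $e^{-it|\xi|^2}\eta(\xi/\lambda)$, that is, $$e^{it\Delta}\eta(\tfrac D\lambda)f(x)=\int_{\mathbb R^d}K_{\lambda,t}(x-y)f(y)\,dy,\qquad K_{\lambda,t}(x)=\frac1{(2\pi)^d}\int_{\mathbb R^d}\eta(\tfrac{\xi}{\lambda})\,e^{-it|\xi|^2+i\langle x,\xi\rangle}\,d\xi ,$$ and define $$\mathfrak a_\lambda(p;q,r)=\sup_{\|f\|_{L^p(\mathbb R^d)}\le 1}\Big\|\Big(\int_{1/2}^1\big|e^{it\Delta}\eta(\tfrac D\lambda)f\big|^r\,dt\Big)^{1/r}\Big\|_{L^q(\mathbb R^d)}\in[0,\infty].$$ Then there are constants $c>0$ and $\lambda_0>1$, depending only on $d,p,q,r$ and $\eta$, such that for all $\lambda\ge\lambda_0$ $$\mathfrak a_\lambda(p;q,r)\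 \ge\ c\,\lambda^{\frac1q-\frac1p}(\log\lambda)^{\frac12-\frac1r}.$$ -/

import Mathlib

open scoped ENNReal ContDiff

namespace SchrodingerLocalized

/-- The convolution kernel of the Fourier multiplier `m` on `ℝ^d`, i.e. its inverse Fourier
transform `(2π)^{-d} ∫ m(ξ) e^{i⟨x,ξ⟩} dξ`
(for the convention `f̂(ξ) = ∫ f(y) e^{-i⟨y,ξ⟩} dy`). -/
noncomputable def kernel {d : ℕ} (m : EuclideanSpace ℝ (Fin d) → ℂ)
    (x : EuclideanSpace ℝ (Fin d)) : ℂ :=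
  ((2 * (Real.pi : ℂ)) ^ d)⁻¹ *
    ∫ ξ : EuclideanSpace ℝ (Fin d), m ξ * Complex.exp (Complex.I * ((inner ℝ x ξ : ℝ) : ℂ))

/-- The operator `m(D)`: convolution with the kernel of the multiplier `m`. It is used for
smooth compactly supported `m`, whose kernel is a Schwartz function, so that the integral
converges absolutely for every `f` in any `L^p`, `1 ≤ p ≤ ∞`. -/
noncomputable def multiplierOp {d : ℕ} (m : EuclideanSpace ℝ (Fin d) → ℂ)
    (f : EuclideanSpace ℝ (Fin d) → ℂ) (x : EuclideanSpace ℝ (Fin d)) : ℂ :=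
  ∫ y : EuclideanSpace ℝ (Fin d), kernel m (x - y) * f y

/-- The multiplier `e^{-it|ξ|²} η(ξ/λ)` of the operator `e^{itΔ} η(D/λ)`. -/
noncomputable def multiplier {d : ℕ} (η : EuclideanSpace ℝ (Fin d) → ℂ) (lam t : ℝ)
    (ξ : EuclideanSpace ℝ (Fin d)) : ℂ :=
  Complex.exp (-Complex.I * (t : ℂ) * ((‖ξ‖ ^ 2 : ℝ) : ℂ)) * η (lam⁻¹ • ξ)

/-- `(e^{itΔ} η(D/λ) f)(x)`. -/
noncomputable def evolution {d : ℕ} (η : EuclideanSpace ℝ (Fin d) → ℂ) (lam : ℝ)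
    (f : EuclideanSpace ℝ (Fin d) → ℂ) (x : EuclideanSpace ℝ (Fin d)) (t : ℝ) : ℂ :=
  multiplierOp (multiplier η lam t) f x

/-- The norm of `u(x,t)` in `L^q(ℝ^d; L^r([1/2,1]))`, with values in `[0,∞]`. -/
noncomputable def mixedNorm {d : ℕ} (q r : ℝ) (u : EuclideanSpace ℝ (Fin d) → ℝ → ℂ) : ℝ≥0∞ :=
  (∫⁻ x : EuclideanSpace ℝ (Fin d),
    (∫⁻ t in Set.Icc (1 / 2 : ℝ) 1, ‖u x t‖ₑ ^ r) ^ (q / r)) ^ (1 / q)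

/-- The operator norm of `f ↦ e^{itΔ} η(D/λ) f` from `L^p(ℝ^d)` to `L^q(ℝ^d; L^r([1/2,1]))`,
with values in `[0,∞]`. -/
noncomputable def localizedNorm {d : ℕ} (η : EuclideanSpace ℝ (Fin d) → ℂ)
    (p q r lam : ℝ) : ℝ≥0∞ :=
  ⨆ (f : EuclideanSpace ℝ (Fin d) → ℂ)
    (_ : MeasureTheory.MemLp f (ENNReal.ofReal p) MeasureTheory.volume)
    (_ : MeasureTheory.eLpNorm f (ENNReal.ofReal p) MeasureTheory.volume ≤ 1),
    mixedNorm q r (evolution η lam f)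

end SchrodingerLocalized

/-! Test the operator on N = 2^n ≈ λ wave packets of unit width, all moving along one direction e,
with frequencies near v_S e where λ ≤ v_S ≤ 2λ. For times in [0,1] such a packet stays coherent on
the unit scale and travels with velocity 2 v_S e (`norm_freeEvolution_packetSymbol`,
`half_integral_le_norm_freeEvolution`). The starting points are 1-separated, so for any choice of
signs the datum has L^p norm O(N^{1/p}) (`exists_packet_sum_bounds`,
`eLpNorm_le_of_bound_of_lintegral`).

Starting points and velocities are coupled through binary digits, a Besicovitch-type compression: at
each time in [3/4,1] the packets together occupy volume O(N/n) only (`linePosition_cluster`,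
`volume_iUnion_packets_le`). By Chebyshev, discarding few points x leaves a space-time set W whose
time slices have length O(1/n) and which keeps at least half of the total mass of the tubes
(`exists_compressed_set`). Suitable signs give ‖u‖_{L²(W)} ≳ N^{1/2} for the evolution u
(`exists_signs_lintegral_sq_ge`). Since W lies over a set of volume O(λ), Hölder in t and then in x
(`setLIntegral_sq_le_mixedNorm`) yields N^{1/2} ≲ 𝔞_λ · N^{1/p} · n^{-(1/2-1/r)} · λ^{1/2-1/q},
which is the claim because N ≈ λ and n ≈ log λ. -/

namespace SchrodingerLocalized

/-! ### Fourier inversion and the action of multipliers -/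

section FourierMultiplier

open MeasureTheory Complex FourierTransform

/-- The unnormalized inverse Fourier integral `x ↦ ∫ H(ξ) e^{i⟨x,ξ⟩} dξ`. -/
noncomputable def oscIntegral {d : ℕ} (H : EuclideanSpace ℝ (Fin d) → ℂ)
    (x : EuclideanSpace ℝ (Fin d)) : ℂ :=
  ∫ ξ : EuclideanSpace ℝ (Fin d), H ξ * exp (I * ((inner ℝ x ξ : ℝ) : ℂ))

variable {d : ℕ}

lemma continuous_oscIntegral {H : EuclideanSpace ℝ (Fin d) → ℂ} (hH : Integrable H) :
    Continuous (oscIntegral H) := by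
  refine continuous_of_dominated (bound := fun ξ => ‖H ξ‖) ?_ ?_ hH.norm ?_
  · intro x
    exact hH.aestronglyMeasurable.mul (by fun_prop)
  · intro x
    filter_upwards with ξ
    simp
  · filter_upwards with ξ
    fun_prop

lemma oscIntegral_eq_fourierInv (H : EuclideanSpace ℝ (Fin d) → ℂ)
    (x : EuclideanSpace ℝ (Fin d)) :
    oscIntegral H x = 𝓕⁻ H ((2 * Real.pi)⁻¹ • x) := by
  rw [Real.fourierInv_eq', oscIntegral]
  congr 1
  ext ξ
  rw [smul_eq_mul, mul_comm, real_inner_smul_right, real_inner_comm]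
  congr 2
  have : (Real.pi : ℂ) ≠ 0 := by exact_mod_cast Real.pi_ne_zero
  push_cast
  field_simp

lemma oscIntegral_eq_schwartz (H : SchwartzMap (EuclideanSpace ℝ (Fin d)) ℂ)
    (x : EuclideanSpace ℝ (Fin d)) :
    oscIntegral H x = (𝓕⁻ H) ((2 * Real.pi)⁻¹ • x) := by
  rw [oscIntegral_eq_fourierInv, SchwartzMap.fourierInv_coe]

lemma integrable_oscIntegral (H : SchwartzMap (EuclideanSpace ℝ (Fin d)) ℂ) :
    Integrable (oscIntegral H) := by
  have h : oscIntegral H = fun x => (𝓕⁻ H) ((2 * Real.pi)⁻¹ • x) := by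
    ext x; exact oscIntegral_eq_schwartz H x
  rw [h]
  exact (SchwartzMap.integrable (𝓕⁻ H)).comp_smul (by positivity)

/-- Quadratic decay is all that is needed to sum over 1-separated packets. -/
lemma exists_decay_oscIntegral (H : SchwartzMap (EuclideanSpace ℝ (Fin d)) ℂ) :
    ∃ C : ℝ, 0 < C ∧ ∀ x, ‖oscIntegral H x‖ ≤ C / (1 + ‖x‖ ^ 2) := by
  obtain ⟨C₀, h₀, hC₀⟩ := SchwartzMap.decay (𝓕⁻ H) 0 0
  obtain ⟨C₂, h₂, hC₂⟩ := SchwartzMap.decay (𝓕⁻ H) 2 0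
  refine ⟨C₀ + (2 * Real.pi) ^ 2 * C₂, by positivity, fun x => ?_⟩
  rw [oscIntegral_eq_schwartz, le_div_iff₀ (by positivity)]
  have e₀ := hC₀ ((2 * Real.pi)⁻¹ • x)
  have e₂ := hC₂ ((2 * Real.pi)⁻¹ • x)
  simp only [norm_iteratedFDeriv_zero, pow_zero, one_mul] at e₀ e₂
  rw [norm_smul, Real.norm_of_nonneg (by positivity), mul_pow, inv_pow] at e₂
  have hp : (0 : ℝ) < (2 * Real.pi) ^ 2 := by positivity
  rw [mul_assoc, inv_mul_le_iff₀ hp] at e₂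
  linarith

/-- Fourier inversion without 2π in the phase; rescaling by 2π produces the factor (2π)^d. -/
lemma integral_oscIntegral_mul_exp (H : SchwartzMap (EuclideanSpace ℝ (Fin d)) ℂ)
    (ξ : EuclideanSpace ℝ (Fin d)) :
    ∫ y, oscIntegral H y * exp (-I * ((inner ℝ y ξ : ℝ) : ℂ)) =
      (2 * (Real.pi : ℂ)) ^ d * H ξ := by
  have h := Measure.integral_comp_smul_of_nonneg (volume : Measure (EuclideanSpace ℝ (Fin d)))
    (fun z => (𝓕⁻ H) z * exp (-(2 * Real.pi * I) * ((inner ℝ z ξ : ℝ) : ℂ)))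
    (2 * Real.pi)⁻¹ (hR := by positivity)
  have h' : 𝓕 (𝓕⁻ H) ξ = H ξ := by rw [FourierTransform.fourier_fourierInv_eq]
  rw [SchwartzMap.fourier_coe, Real.fourier_eq'] at h'
  have e : ∫ z, (𝓕⁻ H) z * exp (-(2 * Real.pi * I) * ((inner ℝ z ξ : ℝ) : ℂ)) = H ξ := by
    rw [← h']
    congr 1
    ext z
    rw [smul_eq_mul, mul_comm]
    congr 2
    push_cast
    ring
  rw [e] at h
  have hpi : (Real.pi : ℂ) ≠ 0 := by exact_mod_cast Real.pi_ne_zero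
  calc _ = ∫ x, (𝓕⁻ H) ((2 * Real.pi)⁻¹ • x) *
        exp (-(2 * Real.pi * I) * ((inner ℝ ((2 * Real.pi)⁻¹ • x) ξ : ℝ) : ℂ)) := by
        congr 1
        ext x
        rw [oscIntegral_eq_schwartz, real_inner_smul_left]
        congr 2
        push_cast
        field_simp
    _ = _ := by
        rw [h, finrank_euclideanSpace_fin, Complex.real_smul, inv_pow, inv_inv]
        push_cast
        rfl

/-- A Fourier multiplier acts on inverse Fourier integrals by multiplication. -/
lemma multiplierOp_oscIntegral {m : EuclideanSpace ℝ (Fin d) → ℂ} (hm : Integrable m)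
    (H : SchwartzMap (EuclideanSpace ℝ (Fin d)) ℂ) (x : EuclideanSpace ℝ (Fin d)) :
    multiplierOp m (oscIntegral H) x = oscIntegral (fun ξ => m ξ * H ξ) x := by
  have hpi : (2 * (Real.pi : ℂ)) ^ d ≠ 0 :=
    pow_ne_zero _ (mul_ne_zero two_ne_zero (by exact_mod_cast Real.pi_ne_zero))
  have hF := integrable_oscIntegral H
  -- The phase is unimodular, so Fubini is justified by a product of two integrable functions.
  have hint : Integrable (Function.uncurry fun (y ξ : EuclideanSpace ℝ (Fin d)) =>
      (oscIntegral H y * m ξ) * exp (I * ((inner ℝ (x - y) ξ : ℝ) : ℂ))) := by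
    refine (hF.mul_prod hm).mono ?_ ?_
    · exact (hF.mul_prod hm).aestronglyMeasurable.mul
        (Continuous.aestronglyMeasurable (by fun_prop))
    · filter_upwards with z
      simp [Function.uncurry]
  calc multiplierOp m (oscIntegral H) x
      = ((2 * (Real.pi : ℂ)) ^ d)⁻¹ * ∫ y, ∫ ξ,
          (oscIntegral H y * m ξ) * exp (I * ((inner ℝ (x - y) ξ : ℝ) : ℂ)) := by
        rw [multiplierOp, ← integral_const_mul]
        congr 1
        ext y
        rw [kernel, mul_assoc, ← integral_mul_const]
        congr 2
        ext ξ
        ring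
    _ = ((2 * (Real.pi : ℂ)) ^ d)⁻¹ * ∫ ξ, ∫ y,
          (oscIntegral H y * m ξ) * exp (I * ((inner ℝ (x - y) ξ : ℝ) : ℂ)) := by
        rw [integral_integral_swap hint]
    _ = ((2 * (Real.pi : ℂ)) ^ d)⁻¹ * ∫ ξ, (2 * (Real.pi : ℂ)) ^ d *
          (m ξ * H ξ * exp (I * ((inner ℝ x ξ : ℝ) : ℂ))) := by
        congr 2
        ext ξ
        have e := integral_oscIntegral_mul_exp H ξ
        calc _ = ∫ y, (m ξ * exp (I * ((inner ℝ x ξ : ℝ) : ℂ))) *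
              (oscIntegral H y * exp (-I * ((inner ℝ y ξ : ℝ) : ℂ))) := by
              congr 1
              ext y
              have : exp (I * ((inner ℝ (x - y) ξ : ℝ) : ℂ)) =
                  exp (I * ((inner ℝ x ξ : ℝ) : ℂ)) * exp (-I * ((inner ℝ y ξ : ℝ) : ℂ)) := by
                rw [← Complex.exp_add, inner_sub_left]
                congr 1
                push_cast
                ring
              rw [this]
              ring
          _ = _ := by
              rw [integral_const_mul, e]
              ring
    _ = _ := by
        rw [integral_const_mul, ← mul_assoc, inv_mul_cancel₀ hpi, one_mul, oscIntegral]

end FourierMultiplier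

/-! ### A compressed family of lines indexed by binary digits -/

section LinePositions

open Finset

/-- Positions at time `τ` of the dyadic family of lines indexed by sets `S` of binary digits,
`y = ∑_{j ∈ S} 2^{n-j-1} (τ - j / n)`. Their union has small time slices for `τ ∈ [0, 1/2]`, while
at `τ = 2` they are separated. -/
noncomputable def linePosition (n : ℕ) (S : Finset ℕ) (τ : ℝ) : ℝ :=
  ∑ j ∈ S, 2 ^ n / 2 ^ (j + 1) * (τ - j / n)

/-- The slope of the line `linePosition n S`. -/
noncomputable def lineSlope (n : ℕ) (S : Finset ℕ) : ℝ :=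
  ∑ j ∈ S, 2 ^ n / 2 ^ (j + 1)

lemma linePosition_eq (n : ℕ) (S : Finset ℕ) (τ τ' : ℝ) :
    linePosition n S τ = linePosition n S τ' + (τ - τ') * lineSlope n S := by
  rw [linePosition, linePosition, lineSlope, mul_sum, ← sum_add_distrib]
  exact sum_congr rfl fun j _ => by ring

lemma sum_Ico_two_pow_div (n k : ℕ) (hk : k ≤ n) :
    ∑ j ∈ Ico k n, (2 : ℝ) ^ n / 2 ^ (j + 1) = 2 ^ n / 2 ^ k - 1 := by
  have h : ∀ m, ∑ i ∈ range m, (2 : ℝ) ^ n / 2 ^ (k + i + 1) = 2 ^ n / 2 ^ k - 2 ^ n / 2 ^ (k + m) := by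
    intro m
    induction m with
    | zero => simp
    | succ m ih =>
      rw [sum_range_succ, ih]
      field_simp
      ring
  rw [sum_Ico_eq_sum_range, h, Nat.add_sub_cancel' hk, div_self (by positivity)]

lemma lineSlope_nonneg (n : ℕ) (S : Finset ℕ) : 0 ≤ lineSlope n S :=
  sum_nonneg fun _ _ => by positivity

lemma lineSlope_le {n : ℕ} {S : Finset ℕ} (hS : S ⊆ range n) : lineSlope n S ≤ 2 ^ n := by
  have h := sum_Ico_two_pow_div n 0 (Nat.zero_le n)
  rw [← range_eq_Ico] at h
  have h' : lineSlope n S ≤ ∑ j ∈ range n, (2 : ℝ) ^ n / 2 ^ (j + 1) :=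
    sum_le_sum_of_subset_of_nonneg hS fun _ _ _ => by positivity
  rw [h] at h'
  simp at h'
  linarith

lemma abs_linePosition_le {n : ℕ} {S : Finset ℕ} (hS : S ⊆ range n) {τ : ℝ} (h0 : 0 ≤ τ)
    (h1 : τ ≤ 1) : |linePosition n S τ| ≤ 2 ^ n := by
  refine le_trans ?_ (lineSlope_le hS)
  refine (abs_sum_le_sum_abs _ _).trans (sum_le_sum fun j hj => ?_)
  have hjn : j < n := mem_range.1 (hS hj)
  have hj0 : (0 : ℝ) ≤ j / n := by positivity
  have hj1 : (j : ℝ) / n ≤ 1 := div_le_one_of_le₀ (by exact_mod_cast hjn.le) (by positivity)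
  rw [abs_mul, abs_of_nonneg (by positivity)]
  exact mul_le_of_le_one_right (by positivity) (abs_le.2 ⟨by linarith, by linarith⟩)

/-- If each term dominates the sum of the later ones, subset sums are `1`-separated. -/
lemma one_le_abs_subset_sum_sub {n : ℕ} {c : ℕ → ℝ} (hc : ∀ j < n, 0 ≤ c j)
    (hdom : ∀ j < n, 1 + ∑ i ∈ Ico (j + 1) n, c i ≤ c j) {S T : Finset ℕ} (hS : S ⊆ range n)
    (hT : T ⊆ range n) (hne : S ≠ T) : 1 ≤ |∑ i ∈ S, c i - ∑ i ∈ T, c i| := by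
  -- S gains c j at the index j, while T \ S lies strictly beyond j, where the whole tail is worth
  -- at most c j - 1.
  have key : ∀ S T : Finset ℕ, S ⊆ range n → T ⊆ range n → ∀ j ∈ S \ T,
      (∀ i ∈ T \ S, j ≤ i) → 1 ≤ ∑ i ∈ S, c i - ∑ i ∈ T, c i := by
    intro S T hS hT j hj hmin
    rw [← sum_sdiff_sub_sum_sdiff]
    have hjS := (mem_sdiff.1 hj).1
    have hjn := mem_range.1 (hS hjS)
    have h1 : c j ≤ ∑ i ∈ S \ T, c i :=
      single_le_sum (f := c) (fun i hi => hc i (mem_range.1 (hS (mem_sdiff.1 hi).1))) hj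
    have h2 : ∑ i ∈ T \ S, c i ≤ ∑ i ∈ Ico (j + 1) n, c i := by
      refine sum_le_sum_of_subset_of_nonneg (fun i hi => ?_) fun i hi _ => hc i (mem_Ico.1 hi).2
      have hi' := mem_sdiff.1 hi
      have hij : i ≠ j := fun h => hi'.2 (h ▸ hjS)
      have := hmin i hi
      exact mem_Ico.2 ⟨by omega, mem_range.1 (hT hi'.1)⟩
    linarith [hdom j hjn]
  have hnon : (symmDiff S T).Nonempty := by
    rw [nonempty_iff_ne_empty]
    exact fun h => hne (symmDiff_eq_bot.1 h)
  set j := (symmDiff S T).min' hnon with hj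
  have hmem := (symmDiff S T).min'_mem hnon
  have hmin : ∀ i ∈ symmDiff S T, j ≤ i := fun i hi => min'_le _ i hi
  rw [← hj] at hmem
  rcases mem_symmDiff.1 hmem with h | h
  · refine (key S T hS hT j (mem_sdiff.2 h) fun i hi => hmin i ?_).trans (le_abs_self _)
    exact mem_symmDiff.2 (Or.inr (mem_sdiff.1 hi))
  · rw [abs_sub_comm]
    refine (key T S hT hS j (mem_sdiff.2 h) fun i hi => hmin i ?_).trans (le_abs_self _)
    exact mem_symmDiff.2 (Or.inl (mem_sdiff.1 hi))

/-- At τ = 2 the digit j has weight 2^{n-j-1}(2 - j/n), whose second factor is at least 1 and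
decreasing in j. Hence the later weights sum to at most (2^{n-j-1} - 1)(2 - j/n), short of the
weight of j by at least 1. -/
lemma linePosition_two_separated {n : ℕ} {S T : Finset ℕ} (hS : S ⊆ range n)
    (hT : T ⊆ range n) (hne : S ≠ T) : 1 ≤ |linePosition n S 2 - linePosition n T 2| := by
  have hle : ∀ j < n, (j : ℝ) / n ≤ 1 := fun j hj =>
    div_le_one_of_le₀ (by exact_mod_cast hj.le) (by positivity)
  refine one_le_abs_subset_sum_sub (c := fun j => 2 ^ n / 2 ^ (j + 1) * (2 - (j : ℝ) / n))
    (fun j hj => ?_) (fun j hj => ?_) hS hT hne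
  · have := hle j hj
    exact mul_nonneg (by positivity) (by linarith)
  · have h : ∑ i ∈ Ico (j + 1) n, (2 : ℝ) ^ n / 2 ^ (i + 1) * (2 - (i : ℝ) / n) ≤
        ∑ i ∈ Ico (j + 1) n, (2 : ℝ) ^ n / 2 ^ (i + 1) * (2 - (j : ℝ) / n) := by
      refine sum_le_sum fun i hi => ?_
      have : (j : ℝ) ≤ i := by exact_mod_cast (by have := (mem_Ico.1 hi).1; omega : j ≤ i)
      gcongr
    rw [← sum_mul, sum_Ico_two_pow_div n (j + 1) hj] at h
    have := hle j hj
    linarith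

lemma sum_range_succ_div_two_pow_le (m : ℕ) :
    ∑ i ∈ range m, ((i : ℝ) + 1) / 2 ^ (i + 1) ≤ 2 := by
  have h : ∑ i ∈ range m, ((i : ℝ) + 1) / 2 ^ (i + 1) = 2 - (m + 2) / 2 ^ m := by
    induction m with
    | zero => simp
    | succ m ih =>
      rw [sum_range_succ, ih]
      push_cast
      field_simp
      ring
  rw [h]
  have : (0 : ℝ) ≤ (m + 2) / 2 ^ m := by positivity
  linarith

/-- At each time in `[0, 1/2]` the positions cluster around `2^k` points. -/
lemma linePosition_cluster {n : ℕ} (hn : 1 ≤ n) {τ : ℝ} (h0 : 0 ≤ τ) (h1 : τ ≤ 1 / 2) :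
    ∃ k : ℕ, 2 * k ≤ n ∧ ∀ S ⊆ range n,
      |linePosition n S τ - linePosition n (S ∩ range k) τ| ≤ 2 * (2 ^ n / 2 ^ k / n) := by
  have hn' : (0 : ℝ) < n := by exact_mod_cast hn
  -- The contribution of digit j vanishes at τ = j/n. With k = ⌊nτ⌋ the digits j ≥ k satisfy |τ -
  -- j/n| ≤ (j-k+1)/n, and their geometric weights make the total O(2^{n-k}/n). The digits below k
  -- give the cluster centres.
  refine ⟨⌊n * τ⌋₊, ?_, fun S hS => ?_⟩
  · have h := Nat.floor_le (show 0 ≤ n * τ by positivity)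
    have : (2 * ⌊n * τ⌋₊ : ℝ) ≤ n := by nlinarith
    exact_mod_cast this
  set k := ⌊n * τ⌋₊ with hk
  have hk1 : (k : ℝ) ≤ n * τ := Nat.floor_le (by positivity)
  have hk2 : n * τ < k + 1 := Nat.lt_floor_add_one _
  rw [linePosition, linePosition, ← sum_sdiff_sub_sum_sdiff]
  have he : (S ∩ range k) \ S = ∅ := by ext; simp; tauto
  rw [he, sum_empty, sub_zero]
  have hterm : ∀ j ∈ S \ (S ∩ range k), |(2 : ℝ) ^ n / 2 ^ (j + 1) * (τ - j / n)| ≤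
      2 ^ n / 2 ^ (j + 1) * ((j - k + 1) / n) := by
    intro j hj
    have hkj : k ≤ j := by
      simp only [mem_sdiff, mem_inter, mem_range, not_and, not_lt] at hj
      exact hj.2 hj.1
    have hkj' : (k : ℝ) ≤ j := by exact_mod_cast hkj
    rw [abs_mul, abs_of_nonneg (by positivity)]
    refine mul_le_mul_of_nonneg_left ?_ (by positivity)
    have : τ - j / n = (n * τ - j) / n := by field_simp
    rw [this, abs_div, abs_of_pos hn']
    gcongr
    exact abs_le.2 ⟨by linarith, by linarith⟩
  calc |∑ j ∈ S \ (S ∩ range k), (2 : ℝ) ^ n / 2 ^ (j + 1) * (τ - j / n)|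
      ≤ ∑ j ∈ S \ (S ∩ range k), (2 : ℝ) ^ n / 2 ^ (j + 1) * ((j - k + 1) / n) :=
        (abs_sum_le_sum_abs _ _).trans (sum_le_sum hterm)
    _ ≤ ∑ j ∈ Ico k n, (2 : ℝ) ^ n / 2 ^ (j + 1) * ((j - k + 1) / n) := by
        refine sum_le_sum_of_subset_of_nonneg (fun j hj => ?_) fun j hj _ => ?_
        · simp only [mem_sdiff, mem_inter, mem_range, not_and, not_lt] at hj
          exact mem_Ico.2 ⟨hj.2 hj.1, mem_range.1 (hS hj.1)⟩
        · have : (k : ℝ) ≤ j := by exact_mod_cast (mem_Ico.1 hj).1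
          exact mul_nonneg (by positivity) (div_nonneg (by linarith) hn'.le)
    _ = 2 ^ n / 2 ^ k / n * ∑ i ∈ range (n - k), ((i : ℝ) + 1) / 2 ^ (i + 1) := by
        rw [sum_Ico_eq_sum_range, mul_sum]
        refine sum_congr rfl fun i _ => ?_
        push_cast
        rw [add_assoc k i 1, pow_add 2 k (i + 1)]
        field_simp
        ring
    _ ≤ _ := by
        rw [mul_comm (2 : ℝ)]
        exact mul_le_mul_of_nonneg_left (sum_range_succ_div_two_pow_le _) (by positivity)

/-- A sum of quadratically decaying bumps at separated points is bounded. -/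
lemma exists_sum_separated_le : ∃ K : ℝ, 0 < K ∧ ∀ {ι : Type} (A : Finset ι) (x : ι → ℝ),
    (∀ i ∈ A, ∀ j ∈ A, i ≠ j → 1 ≤ |x i - x j|) → ∀ s : ℝ,
      ∑ i ∈ A, 1 / (1 + (s - x i) ^ 2) ≤ K := by
  have hsum : Summable fun m : ℤ => 3 / (1 + (m : ℝ) ^ 2) := by
    refine Summable.of_norm_bounded_eventually
      (g := fun m : ℤ => 3 * (1 / (m : ℝ) ^ 2))
      ((Real.summable_one_div_int_pow.2 one_lt_two).mul_left 3) ?_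
    have : {(0 : ℤ)}ᶜ ∈ Filter.cofinite := (Set.finite_singleton _).compl_mem_cofinite
    filter_upwards [this] with m hm
    have hm' : (m : ℝ) ≠ 0 := by exact_mod_cast hm
    have : 0 < (m : ℝ) ^ 2 := by positivity
    rw [Real.norm_of_nonneg (by positivity), mul_one_div]
    gcongr
    linarith
  refine ⟨∑' m : ℤ, 3 / (1 + (m : ℝ) ^ 2), ?_, ?_⟩
  · exact hsum.tsum_pos (fun m => by positivity) 0 (by norm_num)
  intro ι A x hx s
  -- Separation makes the integer parts distinct, so the sum is dominated by one over all integers.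
  -- The constant 3 comes from 1 + m² ≤ 3(1 + y²) when |m - y| ≤ 1.
  have hinj : Set.InjOn (fun i => ⌊x i - s⌋) A := by
    intro i hi j hj hij
    by_contra hne
    have := Int.abs_sub_lt_one_of_floor_eq_floor hij
    have h := hx i hi j hj hne
    rw [sub_sub_sub_cancel_right] at this
    linarith
  calc ∑ i ∈ A, 1 / (1 + (s - x i) ^ 2)
      ≤ ∑ i ∈ A, 3 / (1 + ((⌊x i - s⌋ : ℤ) : ℝ) ^ 2) := by
        refine sum_le_sum fun i _ => ?_
        have h1 := Int.floor_le (x i - s)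
        have h2 := Int.lt_floor_add_one (x i - s)
        set m : ℝ := ((⌊x i - s⌋ : ℤ) : ℝ)
        rw [div_le_div_iff₀ (by positivity) (by positivity)]
        have hf : (m - (x i - s)) ^ 2 ≤ 1 := by
          rw [sq_le_one_iff_abs_le_one]
          exact abs_le.2 ⟨by linarith, by linarith⟩
        nlinarith [sq_nonneg (m - 2 * (x i - s))]
    _ = ∑ m ∈ A.image fun i => ⌊x i - s⌋, 3 / (1 + (m : ℝ) ^ 2) :=
        (sum_image (f := fun m : ℤ => 3 / (1 + (m : ℝ) ^ 2)) hinj).symm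
    _ ≤ _ := hsum.sum_le_tsum _ fun m _ => by positivity

end LinePositions

/-! ### Space-time tubes and their compression -/

section Tubes

open MeasureTheory Set

variable {d : ℕ}

/-- The unit neighbourhood of the segment of half-length `ρ` about `c • e` in direction `e`. -/
def segmentNhd (e : EuclideanSpace ℝ (Fin d)) (c ρ : ℝ) : Set (EuclideanSpace ℝ (Fin d)) :=
  {x | ∃ y : ℝ, |y - c| ≤ ρ ∧ ‖x - y • e‖ ≤ 1}

/-- Balls of radius 2 at unit steps along the segment cover it: one unit for the step, one for the
neighbourhood. -/
lemma volume_segmentNhd_le {e : EuclideanSpace ℝ (Fin d)} (he : ‖e‖ = 1) (c : ℝ) {ρ : ℝ}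
    (hρ : 0 ≤ ρ) :
    volume (segmentNhd e c ρ) ≤
      ENNReal.ofReal ((2 * ρ + 1) * 2 ^ d) *
        volume (Metric.closedBall (0 : EuclideanSpace ℝ (Fin d)) 1) := by
  have hV (z : EuclideanSpace ℝ (Fin d)) : volume (Metric.closedBall z 2) =
      ENNReal.ofReal (2 ^ d) * volume (Metric.closedBall (0 : EuclideanSpace ℝ (Fin d)) 1) := by
    have := Measure.addHaar_closedBall_mul (volume : Measure (EuclideanSpace ℝ (Fin d))) z
      (r := 2) (by norm_num) (s := 1) (by norm_num)
    rwa [mul_one, finrank_euclideanSpace_fin] at this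
  have hsub : segmentNhd e c ρ ⊆
      ⋃ m ∈ Finset.range (⌊2 * ρ⌋₊ + 1), Metric.closedBall ((c - ρ + m) • e) 2 := by
    rintro x ⟨y, hy, hx⟩
    rw [abs_le] at hy
    have hy0 : 0 ≤ y - (c - ρ) := by linarith
    have h1 := Nat.floor_le hy0
    have h2 := Nat.lt_floor_add_one (y - (c - ρ))
    simp only [mem_iUnion, Finset.mem_range]
    refine ⟨⌊y - (c - ρ)⌋₊, Nat.lt_succ_of_le (Nat.floor_mono (by linarith)), ?_⟩
    rw [mem_closedBall_iff_norm]
    set m := ⌊y - (c - ρ)⌋₊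
    have : x - (c - ρ + m) • e = (x - y • e) + (y - (c - ρ + m)) • e := by
      rw [sub_smul]; abel
    rw [this]
    refine (norm_add_le _ _).trans ?_
    rw [norm_smul, he, mul_one, Real.norm_eq_abs]
    have : |y - (c - ρ + m)| ≤ 1 := abs_le.2 ⟨by linarith, by linarith⟩
    linarith
  calc volume (segmentNhd e c ρ)
      ≤ ∑ m ∈ Finset.range (⌊2 * ρ⌋₊ + 1), volume (Metric.closedBall ((c - ρ + m) • e) 2) :=
        (measure_mono hsub).trans (measure_biUnion_finset_le _ _)
    _ = ENNReal.ofReal (((⌊2 * ρ⌋₊ + 1 : ℕ) : ℝ) * 2 ^ d) *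
          volume (Metric.closedBall (0 : EuclideanSpace ℝ (Fin d)) 1) := by
        simp only [hV, Finset.sum_const, Finset.card_range, nsmul_eq_mul]
        rw [ENNReal.ofReal_mul (by positivity), ENNReal.ofReal_natCast, mul_assoc]
    _ ≤ _ := by
        have := Nat.floor_le (show 0 ≤ 2 * ρ by positivity)
        push_cast
        gcongr

/-- The centre at time `t` of the wave packet indexed by `S`. -/
noncomputable def packetCenter (n : ℕ) (lam : ℝ) (S : Finset ℕ) (t : ℝ) : ℝ :=
  linePosition n S 2 + 2 * t * (2 * lam - lineSlope n S)

/-- The clock τ = 2 - 2t sends the start t = 0 to the separated configuration τ = 2, and the window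
[3/4, 1] to the compressed range [0, 1/2]. The drift 4λt is common to all packets and harmless. -/
lemma packetCenter_eq (n : ℕ) (lam : ℝ) (S : Finset ℕ) (t : ℝ) :
    packetCenter n lam S t = linePosition n S (2 - 2 * t) + 4 * lam * t := by
  rw [packetCenter, linePosition_eq n S (2 - 2 * t) 2]
  ring

/-- The space-time tube followed by the wave packet indexed by `S`. -/
def packetTube (e : EuclideanSpace ℝ (Fin d)) (n : ℕ) (lam : ℝ) (S : Finset ℕ) :
    Set (EuclideanSpace ℝ (Fin d) × ℝ) :=
  {z | z.2 ∈ Icc (3 / 4 : ℝ) 1 ∧ ‖z.1 - packetCenter n lam S z.2 • e‖ ≤ 1}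

lemma measurableSet_packetTube (e : EuclideanSpace ℝ (Fin d)) (n : ℕ) (lam : ℝ) (S : Finset ℕ) :
    MeasurableSet (packetTube e n lam S) := by
  have hc : Continuous fun z : EuclideanSpace ℝ (Fin d) × ℝ =>
      ‖z.1 - packetCenter n lam S z.2 • e‖ := by
    unfold packetCenter
    fun_prop
  exact ((isClosed_Icc.preimage continuous_snd).inter
    (isClosed_le hc continuous_const)).measurableSet

/-- The tubes are compressed at each time in `[3/4, 1]`. -/
lemma volume_iUnion_packets_le {e : EuclideanSpace ℝ (Fin d)} (he : ‖e‖ = 1) {n : ℕ} (hn : 1 ≤ n)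
    (lam : ℝ) {t : ℝ} (ht : t ∈ Icc (3 / 4 : ℝ) 1) :
    volume {x | ∃ S ⊆ Finset.range n, ‖x - packetCenter n lam S t • e‖ ≤ 1} ≤
      ENNReal.ofReal (10 * 2 ^ n / n * 2 ^ d) *
        volume (Metric.closedBall (0 : EuclideanSpace ℝ (Fin d)) 1) := by
  have hn' : (0 : ℝ) < n := by exact_mod_cast hn
  obtain ⟨k, hk, hS⟩ := linePosition_cluster hn (τ := 2 - 2 * t) (by linarith [ht.2])
    (by linarith [ht.1])
  set ρ : ℝ := 2 * (2 ^ n / 2 ^ k / n) with hρ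
  have hsub : {x | ∃ S ⊆ Finset.range n, ‖x - packetCenter n lam S t • e‖ ≤ 1} ⊆
      ⋃ P ∈ (Finset.range k).powerset,
        segmentNhd e (linePosition n P (2 - 2 * t) + 4 * lam * t) ρ := by
    rintro x ⟨S, hSn, hx⟩
    simp only [mem_iUnion, Finset.mem_powerset]
    refine ⟨S ∩ Finset.range k, Finset.inter_subset_right, packetCenter n lam S t, ?_, hx⟩
    rw [packetCenter_eq, add_sub_add_right_eq_sub]
    exact hS S hSn
  calc volume {x | ∃ S ⊆ Finset.range n, ‖x - packetCenter n lam S t • e‖ ≤ 1}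
      ≤ ∑ P ∈ (Finset.range k).powerset,
          volume (segmentNhd e (linePosition n P (2 - 2 * t) + 4 * lam * t) ρ) :=
        (measure_mono hsub).trans (measure_biUnion_finset_le _ _)
    _ ≤ ∑ P ∈ (Finset.range k).powerset, ENNReal.ofReal ((2 * ρ + 1) * 2 ^ d) *
          volume (Metric.closedBall (0 : EuclideanSpace ℝ (Fin d)) 1) :=
        Finset.sum_le_sum fun P _ => volume_segmentNhd_le he _ (by positivity)
    _ = ENNReal.ofReal (((2 ^ k : ℕ) : ℝ) * ((2 * ρ + 1) * 2 ^ d)) *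
          volume (Metric.closedBall (0 : EuclideanSpace ℝ (Fin d)) 1) := by
        rw [Finset.sum_const, Finset.card_powerset, Finset.card_range, nsmul_eq_mul,
          ENNReal.ofReal_mul (p := ((2 ^ k : ℕ) : ℝ)) (by positivity), ENNReal.ofReal_natCast,
          mul_assoc]
    _ ≤ _ := by
        gcongr ENNReal.ofReal ?_ * _
        rw [← mul_assoc]
        refine mul_le_mul_of_nonneg_right ?_ (by positivity)
        -- Since k ≤ n/2, the unit thickness of the 2^k clusters costs 2^k = O(2^n/n), no more than
        -- the order of their total length.
        have hpow : n * 2 ^ k ≤ 2 * 2 ^ n := by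
          have h1 : n - k < 2 ^ (n - k) := Nat.lt_two_pow_self
          have h2 : n ≤ 2 * 2 ^ (n - k) := by omega
          calc n * 2 ^ k ≤ 2 * 2 ^ (n - k) * 2 ^ k := Nat.mul_le_mul_right _ h2
            _ = 2 * 2 ^ n := by rw [mul_assoc, ← pow_add, Nat.sub_add_cancel (by omega)]
        have hpow' : (n : ℝ) * 2 ^ k ≤ 2 * 2 ^ n := by exact_mod_cast hpow
        have e1 : ((2 ^ k : ℕ) : ℝ) * (2 * ρ + 1) = (4 * 2 ^ n + n * 2 ^ k) / n := by
          rw [hρ]; push_cast; field_simp; ring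
        rw [e1]
        gcongr
        nlinarith [pow_pos (two_pos : (0 : ℝ) < 2) n]

/-- Projected to e, the centre moves at speed 2v and must lie in an interval of length 2. -/
lemma volume_passage_time_le {e : EuclideanSpace ℝ (Fin d)} (he : ‖e‖ = 1)
    (x : EuclideanSpace ℝ (Fin d)) (a : ℝ) {v : ℝ} (hv : 0 < v) :
    volume {t : ℝ | ‖x - (a + 2 * t * v) • e‖ ≤ 1} ≤ ENNReal.ofReal (1 / v) := by
  have hsub : {t : ℝ | ‖x - (a + 2 * t * v) • e‖ ≤ 1} ⊆
      Icc ((inner ℝ x e - a - 1) / (2 * v)) ((inner ℝ x e - a + 1) / (2 * v)) := by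
    intro t ht
    have h := abs_real_inner_le_norm (x - (a + 2 * t * v) • e) e
    rw [he, mul_one, inner_sub_left, real_inner_smul_left, real_inner_self_eq_norm_sq, he] at h
    have h' := abs_le.1 (h.trans ht)
    constructor
    · rw [div_le_iff₀ (by positivity)]; linarith [h'.2]
    · rw [le_div_iff₀ (by positivity)]; linarith [h'.1]
  refine (measure_mono hsub).trans (le_of_eq ?_)
  rw [Real.volume_Icc]
  congr 1
  field_simp
  ring

lemma volume_packetTube (e : EuclideanSpace ℝ (Fin d)) (n : ℕ) (lam : ℝ) (S : Finset ℕ) :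
    volume (packetTube e n lam S) =
      ENNReal.ofReal (1 / 4) * volume (Metric.closedBall (0 : EuclideanSpace ℝ (Fin d)) 1) := by
  rw [Measure.volume_eq_prod, Measure.prod_apply_symm (measurableSet_packetTube e n lam S)]
  have : ∀ t : ℝ, volume ((fun x => (x, t)) ⁻¹' packetTube e n lam S) =
      (Icc (3 / 4 : ℝ) 1).indicator
        (fun _ => volume (Metric.closedBall (0 : EuclideanSpace ℝ (Fin d)) 1)) t := by
    intro t
    by_cases ht : t ∈ Icc (3 / 4 : ℝ) 1
    · rw [indicator_of_mem ht,
        ← Measure.addHaar_closedBall_center volume (packetCenter n lam S t • e)]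
      congr 1
      ext x
      simp only [packetTube, mem_preimage, mem_ofPred_eq, ht, true_and, mem_closedBall_iff_norm]
    · rw [indicator_of_notMem ht]
      convert measure_empty (μ := volume)
      ext x
      simp only [packetTube, mem_preimage, mem_ofPred_eq, ht, false_and, mem_empty_iff_false]
  simp_rw [this]
  rw [lintegral_indicator measurableSet_Icc, setLIntegral_const, Real.volume_Icc, mul_comm]
  norm_num

/-- The drift contributes at most 4λ, the line position at most 2^n ≤ λ. -/
lemma packetCenter_abs_le {n : ℕ} {lam : ℝ} (hlam : 2 ^ n ≤ lam) {S : Finset ℕ}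
    (hS : S ⊆ Finset.range n) {t : ℝ} (ht : t ∈ Icc (3 / 4 : ℝ) 1) :
    |packetCenter n lam S t| ≤ 5 * lam := by
  have h0 : (0 : ℝ) < 2 ^ n := by positivity
  have h := abs_le.1 (abs_linePosition_le hS (τ := 2 - 2 * t) (by linarith [ht.2])
    (by linarith [ht.1]))
  rw [packetCenter_eq, abs_le]
  constructor <;> nlinarith [ht.1, ht.2, h.1, h.2]

/-- A space-time set with short time slices which carries a fixed proportion of the mass of
the tubes. -/
lemma exists_compressed_set {e : EuclideanSpace ℝ (Fin d)} (he : ‖e‖ = 1) {n : ℕ} (hn : 1 ≤ n)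
    {lam : ℝ} (hlam : 2 ^ n ≤ lam) :
    ∃ W : Set (EuclideanSpace ℝ (Fin d) × ℝ), MeasurableSet W ∧
      (∀ z ∈ W, z.2 ∈ Icc (3 / 4 : ℝ) 1 ∧ z.1 ∈ segmentNhd e 0 (5 * lam)) ∧
      (∀ x, volume {t | (x, t) ∈ W} ≤ ENNReal.ofReal (20 * 2 ^ d / n)) ∧
      ENNReal.ofReal (2 ^ n / 8) * volume (Metric.closedBall (0 : EuclideanSpace ℝ (Fin d)) 1) ≤
        ∑ S ∈ (Finset.range n).powerset, volume (W ∩ packetTube e n lam S) := by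
  have hn' : (0 : ℝ) < n := by exact_mod_cast hn
  have hlam0 : 0 < lam := lt_of_lt_of_le (by positivity) hlam
  set v₁ := volume (Metric.closedBall (0 : EuclideanSpace ℝ (Fin d)) 1) with hv₁
  have hv₁top : v₁ ≠ ⊤ := measure_closedBall_lt_top.ne
  set U := ⋃ S ∈ (Finset.range n).powerset, packetTube e n lam S with hU
  have hUm : MeasurableSet U :=
    Finset.measurableSet_biUnion _ fun S _ => measurableSet_packetTube e n lam S
  -- The threshold is chosen so that the bound for the volume of U equals α · (2^n/8) v₁; Chebyshev
  -- then bounds the volume of B by half of the total tube mass (2^n/4) v₁.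
  set α := ENNReal.ofReal (20 * 2 ^ d / n) with hα
  have hα0 : α ≠ 0 := by rw [hα, Ne, ENNReal.ofReal_eq_zero, not_le]; positivity
  have hαtop : α ≠ ⊤ := ENNReal.ofReal_ne_top
  have hslice : Measurable fun x => volume (Prod.mk x ⁻¹' U : Set ℝ) :=
    measurable_measure_prodMk_left hUm
  set B := {x | α ≤ volume (Prod.mk x ⁻¹' U : Set ℝ)} with hB
  have hBm : MeasurableSet B := measurableSet_le measurable_const hslice
  have hvolU : volume U ≤ ENNReal.ofReal (1 / 4) *
      (ENNReal.ofReal (10 * 2 ^ n / n * 2 ^ d) * v₁) := by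
    rw [Measure.volume_eq_prod, Measure.prod_apply_symm hUm]
    have : ∀ t : ℝ, volume ((fun x => (x, t)) ⁻¹' U) ≤ (Icc (3 / 4 : ℝ) 1).indicator
        (fun _ => ENNReal.ofReal (10 * 2 ^ n / n * 2 ^ d) * v₁) t := by
      intro t
      by_cases ht : t ∈ Icc (3 / 4 : ℝ) 1
      · rw [indicator_of_mem ht]
        refine le_trans (measure_mono ?_) (volume_iUnion_packets_le he hn lam ht)
        intro x hx
        simp only [hU, mem_preimage, mem_iUnion, Finset.mem_powerset] at hx
        obtain ⟨S, hS, hx⟩ := hx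
        exact ⟨S, hS, hx.2⟩
      · rw [indicator_of_notMem ht]
        refine le_of_eq ?_
        convert measure_empty (μ := volume)
        ext x
        simp only [hU, mem_preimage, mem_iUnion, mem_empty_iff_false, iff_false, not_exists]
        exact fun S _ hx => ht hx.1
    refine (lintegral_mono this).trans (le_of_eq ?_)
    rw [lintegral_indicator measurableSet_Icc, setLIntegral_const, Real.volume_Icc, mul_comm]
    norm_num
  have hvolB : volume B ≤ ENNReal.ofReal (2 ^ n / 8) * v₁ := by
    have h1 : α * volume B ≤ volume U := by
      rw [Measure.volume_eq_prod, Measure.prod_apply hUm]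
      exact mul_meas_ge_le_lintegral hslice α
    rw [← ENNReal.mul_le_mul_iff_right hα0 hαtop]
    refine (h1.trans hvolU).trans (le_of_eq ?_)
    rw [← mul_assoc, ← mul_assoc, hα, ← ENNReal.ofReal_mul (by positivity),
      ← ENNReal.ofReal_mul (by positivity)]
    congr 2
    field_simp
    norm_num
  refine ⟨U ∩ Prod.fst ⁻¹' Bᶜ, hUm.inter (measurable_fst hBm.compl), ?_, ?_, ?_⟩
  · rintro z ⟨hz, -⟩
    simp only [hU, mem_iUnion, Finset.mem_powerset] at hz
    obtain ⟨S, hS, hz⟩ := hz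
    exact ⟨hz.1, packetCenter n lam S z.2,
      by rw [sub_zero]; exact packetCenter_abs_le hlam hS hz.1, hz.2⟩
  · intro x
    by_cases hx : x ∈ B
    · convert zero_le (a := α)
      convert measure_empty (μ := volume)
      ext t
      simp [hx]
    · refine (measure_mono (t := Prod.mk x ⁻¹' U) fun t ht => ht.1).trans (le_of_lt ?_)
      exact not_le.1 hx
  -- Each tube stays over a given x for time at most 1/λ and there are 2^n ≤ λ tubes, so removing B
  -- costs at most its volume.
  · have hbad : ∑ S ∈ (Finset.range n).powerset, volume (packetTube e n lam S ∩ Prod.fst ⁻¹' B) ≤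
        volume B := by
      have h1 : ∀ S ∈ (Finset.range n).powerset,
          volume (packetTube e n lam S ∩ Prod.fst ⁻¹' B) ≤
            ENNReal.ofReal (1 / lam) * volume B := by
        intro S hS
        rw [Finset.mem_powerset] at hS
        have hv : lam ≤ 2 * lam - lineSlope n S := by linarith [lineSlope_le hS]
        rw [Measure.volume_eq_prod, Measure.prod_apply
          ((measurableSet_packetTube e n lam S).inter (measurable_fst hBm)),
          ← setLIntegral_const, ← lintegral_indicator hBm]
        refine lintegral_mono fun x => ?_
        by_cases hx : x ∈ B
        · rw [indicator_of_mem hx]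
          refine (measure_mono (t := {t : ℝ | ‖x - packetCenter n lam S t • e‖ ≤ 1})
            fun t ht => ht.1.2).trans ?_
          refine (volume_passage_time_le he x _ (hlam0.trans_le hv)).trans ?_
          gcongr
        · rw [indicator_of_notMem hx]
          refine le_of_eq ?_
          convert measure_empty (μ := volume)
          ext t
          simp [hx]
      refine (Finset.sum_le_sum h1).trans ?_
      rw [Finset.sum_const, Finset.card_powerset, Finset.card_range, nsmul_eq_mul, ← mul_assoc,
        ← ENNReal.ofReal_natCast, ← ENNReal.ofReal_mul (by positivity)]
      refine mul_le_of_le_one_left' ?_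
      rw [ENNReal.ofReal_le_one]
      push_cast
      rw [mul_one_div]
      exact div_le_one_of_le₀ hlam hlam0.le
    have htot : ENNReal.ofReal (2 ^ n / 8) * v₁ + ENNReal.ofReal (2 ^ n / 8) * v₁ =
        ∑ S ∈ (Finset.range n).powerset, volume (packetTube e n lam S) := by
      simp only [volume_packetTube]
      rw [Finset.sum_const, Finset.card_powerset, Finset.card_range, nsmul_eq_mul, ← mul_assoc,
        ← add_mul, ← ENNReal.ofReal_add (by positivity) (by positivity),
        ← ENNReal.ofReal_natCast, ← ENNReal.ofReal_mul (by positivity)]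
      congr 2
      push_cast
      ring
    have hfin : ENNReal.ofReal (2 ^ n / 8) * v₁ ≠ ⊤ := ENNReal.mul_ne_top ENNReal.ofReal_ne_top hv₁top
    refine (ENNReal.add_le_add_iff_right hfin).1 ?_
    rw [htot]
    refine le_trans ?_ (add_le_add_right (hbad.trans hvolB) _)
    rw [← Finset.sum_add_distrib]
    refine Finset.sum_le_sum fun S hS => ?_
    refine (measure_mono ?_).trans (measure_union_le _ _)
    intro z hz
    by_cases hzB : z.1 ∈ B
    · exact Or.inr ⟨hz, hzB⟩
    · exact Or.inl ⟨⟨mem_biUnion hS hz, hzB⟩, hz⟩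

end Tubes

/-! ### Choice of signs, Hölder's inequality and interpolation -/

section SignsAndHolder

open MeasureTheory Set

lemma enorm_parallelogram (a b : ℂ) :
    ‖a + b‖ₑ ^ 2 + ‖a - b‖ₑ ^ 2 = 2 * (‖a‖ₑ ^ 2 + ‖b‖ₑ ^ 2) := by
  simp only [← ofReal_norm, ← ENNReal.ofReal_pow (norm_nonneg _)]
  rw [← ENNReal.ofReal_add (by positivity) (by positivity),
    ← ENNReal.ofReal_add (by positivity) (by positivity),
    show (2 : ℝ≥0∞) = ENNReal.ofReal 2 by simp, ← ENNReal.ofReal_mul (by norm_num)]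
  congr 1
  exact parallelogram_law_with_norm ℝ a b

/-- Signs can be chosen so that the squared `L²` norm of the signed sum is at least the sum of the
squared `L²` norms. -/
lemma exists_signs_lintegral_sq_ge {α ι : Type*} [MeasurableSpace α] (μ : Measure α)
    (A : Finset ι) {F : ι → α → ℂ} (hF : ∀ i, Measurable (F i)) :
    ∃ ε : ι → ℝ, (∀ i, |ε i| = 1) ∧
      ∑ i ∈ A, ∫⁻ z, ‖F i z‖ₑ ^ 2 ∂μ ≤ ∫⁻ z, ‖∑ i ∈ A, (ε i : ℂ) * F i z‖ₑ ^ 2 ∂μ := by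
  classical
  induction A using Finset.induction_on with
  | empty => exact ⟨fun _ => 1, fun _ => abs_one, by simp⟩
  | insert a A ha ih =>
    obtain ⟨ε, hε, h⟩ := ih
    set G : α → ℂ := fun z => ∑ i ∈ A, (ε i : ℂ) * F i z with hG
    have hGm : Measurable G := Finset.measurable_sum _ fun i _ => (hF i).const_mul _
    have hsum (s : ℝ) (z : α) :
        ∑ i ∈ insert a A, ((Function.update ε a s i : ℝ) : ℂ) * F i z = s * F a z + G z := by
      rw [Finset.sum_insert ha, Function.update_self]
      congr 1
      refine Finset.sum_congr rfl fun i hi => ?_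
      rw [Function.update_of_ne (ne_of_mem_of_not_mem hi ha)]
    have hupd (s : ℝ) (hs : |s| = 1) (i : ι) : |Function.update ε a s i| = 1 := by
      by_cases hi : i = a
      · subst hi; rwa [Function.update_self]
      · rw [Function.update_of_ne hi]; exact hε i
    have hpar : ∫⁻ z, ‖G z + F a z‖ₑ ^ 2 ∂μ + ∫⁻ z, ‖G z - F a z‖ₑ ^ 2 ∂μ =
        2 * (∫⁻ z, ‖G z‖ₑ ^ 2 ∂μ + ∫⁻ z, ‖F a z‖ₑ ^ 2 ∂μ) := by
      have hm := hF a
      rw [← lintegral_add_left (by fun_prop), ← lintegral_add_left (by fun_prop),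
        ← lintegral_const_mul _ (by fun_prop)]
      exact lintegral_congr fun z => enorm_parallelogram _ _
    have hle : ∑ i ∈ insert a A, ∫⁻ z, ‖F i z‖ₑ ^ 2 ∂μ ≤
        ∫⁻ z, ‖G z‖ₑ ^ 2 ∂μ + ∫⁻ z, ‖F a z‖ₑ ^ 2 ∂μ := by
      rw [Finset.sum_insert ha, add_comm]
      gcongr
    -- By the parallelogram law the two signs average to exactly the sum of squares, so one of them
    -- does at least as well.
    by_cases hc : ∫⁻ z, ‖G z‖ₑ ^ 2 ∂μ + ∫⁻ z, ‖F a z‖ₑ ^ 2 ∂μ ≤ ∫⁻ z, ‖G z + F a z‖ₑ ^ 2 ∂μ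
    · refine ⟨Function.update ε a 1, hupd 1 abs_one, hle.trans (hc.trans (le_of_eq ?_))⟩
      refine lintegral_congr fun z => ?_
      rw [hsum, Complex.ofReal_one, one_mul, add_comm]
    · refine ⟨Function.update ε a (-1), hupd (-1) (by simp), hle.trans ?_⟩
      have hm : ∫⁻ z, ‖∑ i ∈ insert a A, ((Function.update ε a (-1) i : ℝ) : ℂ) * F i z‖ₑ ^ 2 ∂μ =
          ∫⁻ z, ‖G z - F a z‖ₑ ^ 2 ∂μ := by
        refine lintegral_congr fun z => ?_
        rw [hsum]
        congr 2
        push_cast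
        ring
      rw [hm]
      by_contra hc'
      have := ENNReal.add_lt_add (not_le.1 hc) (not_le.1 hc')
      rw [hpar, two_mul] at this
      exact lt_irrefl _ this

/-- Hölder against the constant 1, used in time with exponent r and in space with exponent q. -/
lemma lintegral_sq_rpow_le {α : Type*} [MeasurableSpace α] {μ : Measure α} {f : α → ℝ≥0∞}
    (hf : Measurable f) {q : ℝ} (hq : 2 ≤ q) :
    (∫⁻ a, f a ^ (2 : ℝ) ∂μ) ^ (1 / 2 : ℝ) ≤
      (∫⁻ a, f a ^ q ∂μ) ^ (1 / q) * μ univ ^ (1 / 2 - 1 / q) :=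
  eLpNorm'_le_eLpNorm'_mul_rpow_measure_univ (f := f) two_pos hq hf.aestronglyMeasurable

/-- Hölder's inequality in the mixed norm for a set with short time slices. -/
lemma setLIntegral_sq_le_mixedNorm {d : ℕ} {q r : ℝ} (hq : 2 ≤ q) (hr : 2 ≤ r)
    {u : EuclideanSpace ℝ (Fin d) → ℝ → ℂ} (hu : Measurable (Function.uncurry u))
    {W : Set (EuclideanSpace ℝ (Fin d) × ℝ)} (hW : MeasurableSet W)
    {X : Set (EuclideanSpace ℝ (Fin d))}
    (hWX : ∀ z ∈ W, z.2 ∈ Icc (1 / 2 : ℝ) 1 ∧ z.1 ∈ X) {α β : ℝ≥0∞}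
    (hα : ∀ x, volume {t | (x, t) ∈ W} ≤ α) (hβ : volume X ≤ β) :
    (∫⁻ z in W, ‖u z.1 z.2‖ₑ ^ 2) ^ (1 / 2 : ℝ) ≤
      mixedNorm q r u * α ^ (1 / 2 - 1 / r) * β ^ (1 / 2 - 1 / q) := by
  have hr0 : 0 ≤ 1 / 2 - 1 / r := by
    rw [sub_nonneg]; exact one_div_le_one_div_of_le two_pos hr
  have hq0 : 0 ≤ 1 / 2 - 1 / q := by
    rw [sub_nonneg]; exact one_div_le_one_div_of_le two_pos hq
  have hrpos : 0 < r := by linarith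
  have hux : ∀ x, Measurable (u x) := fun x => hu.comp measurable_prodMk_left
  set φ : EuclideanSpace ℝ (Fin d) → ℝ≥0∞ :=
    fun x => (∫⁻ t in Icc (1 / 2 : ℝ) 1, ‖u x t‖ₑ ^ r) ^ (1 / r) with hφ
  have hφm : Measurable φ := by
    refine Measurable.pow_const ?_ _
    exact (hu.enorm.pow_const r).lintegral_prod_right'
  -- X need not be measurable; its measurable hull has the same volume.
  set X' := toMeasurable volume X with hX'
  have hslice (x : EuclideanSpace ℝ (Fin d)) :
      ∫⁻ t in {t | (x, t) ∈ W}, ‖u x t‖ₑ ^ (2 : ℝ) ≤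
        X'.indicator (fun x => α ^ ((1 / 2 - 1 / r) * 2) * φ x ^ (2 : ℝ)) x := by
    by_cases hx : x ∈ X'
    · rw [indicator_of_mem hx]
      have h := lintegral_sq_rpow_le (μ := volume.restrict {t | (x, t) ∈ W}) (hux x).enorm hr
      rw [Measure.restrict_apply_univ, one_div (2 : ℝ), ENNReal.rpow_inv_le_iff two_pos,
        ENNReal.mul_rpow_of_nonneg _ _ two_pos.le] at h
      refine h.trans ?_
      rw [mul_comm]
      refine mul_le_mul' ?_ ?_
      · rw [← ENNReal.rpow_mul]
        norm_num only
        exact ENNReal.rpow_le_rpow (hα x) (by norm_num at hr0 ⊢; linarith)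
      · refine ENNReal.rpow_le_rpow ?_ two_pos.le
        refine ENNReal.rpow_le_rpow ?_ (by positivity)
        exact lintegral_mono_set fun t ht => (hWX _ ht).1
    · have : {t | (x, t) ∈ W} = ∅ := by
        ext t
        simp only [mem_ofPred_eq, mem_empty_iff_false, iff_false]
        exact fun ht => hx (subset_toMeasurable _ _ (hWX _ ht).2)
      rw [this]
      simp
  have hmain : ∫⁻ z in W, ‖u z.1 z.2‖ₑ ^ 2 ≤
      α ^ ((1 / 2 - 1 / r) * 2) * ∫⁻ x in X', φ x ^ (2 : ℝ) := by
    have hum : Measurable fun z : EuclideanSpace ℝ (Fin d) × ℝ => ‖u z.1 z.2‖ₑ ^ 2 :=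
      hu.enorm.pow_const 2
    rw [← lintegral_indicator hW, Measure.volume_eq_prod, lintegral_prod _
      (hum.indicator hW).aemeasurable,
      ← lintegral_const_mul _ (hφm.pow_const _), ← lintegral_indicator (measurableSet_toMeasurable _ _)]
    refine lintegral_mono fun x => le_trans (le_of_eq ?_) (hslice x)
    have hWx : MeasurableSet {t | (x, t) ∈ W} := measurable_prodMk_left hW
    rw [← lintegral_indicator hWx]
    refine lintegral_congr fun t => ?_
    by_cases ht : (x, t) ∈ W
    · rw [indicator_of_mem ht, indicator_of_mem (s := {t | (x, t) ∈ W}) ht]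
      exact (ENNReal.rpow_natCast _ 2).symm
    · rw [indicator_of_notMem ht, indicator_of_notMem (s := {t | (x, t) ∈ W}) ht]
  have hX'β : volume X' ≤ β := by rwa [hX', measure_toMeasurable]
  have hφq : (∫⁻ x in X', φ x ^ q) ^ (1 / q) ≤ mixedNorm q r u := by
    refine ENNReal.rpow_le_rpow ?_ (by positivity)
    refine (setLIntegral_le_lintegral _ _).trans (le_of_eq (lintegral_congr fun x => ?_))
    rw [hφ, ← ENNReal.rpow_mul, one_div_mul_eq_div]
  calc (∫⁻ z in W, ‖u z.1 z.2‖ₑ ^ 2) ^ (1 / 2 : ℝ)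
      ≤ (α ^ ((1 / 2 - 1 / r) * 2) * ∫⁻ x in X', φ x ^ (2 : ℝ)) ^ (1 / 2 : ℝ) :=
        ENNReal.rpow_le_rpow hmain (by norm_num)
    _ = α ^ (1 / 2 - 1 / r) * (∫⁻ x in X', φ x ^ (2 : ℝ)) ^ (1 / 2 : ℝ) := by
        rw [ENNReal.mul_rpow_of_nonneg _ _ (by norm_num), ← ENNReal.rpow_mul, mul_assoc]
        norm_num
    _ ≤ α ^ (1 / 2 - 1 / r) * (mixedNorm q r u * β ^ (1 / 2 - 1 / q)) := by
        refine mul_le_mul_right ((lintegral_sq_rpow_le hφm hq).trans ?_) _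
        rw [Measure.restrict_apply_univ]
        exact mul_le_mul' hφq (ENNReal.rpow_le_rpow hX'β hq0)
    _ = _ := by ring

/-- The `L^p` norm is controlled by the sup norm and the `L¹` norm. -/
lemma eLpNorm_le_of_bound_of_lintegral {α : Type*} [MeasurableSpace α] {μ : Measure α} {f : α → ℂ}
    {p M L : ℝ} (hp : 1 ≤ p) (hM : 0 < M) (hL : 0 ≤ L) (hfM : ∀ x, ‖f x‖ ≤ M)
    (hfL : ∫⁻ x, ‖f x‖ₑ ∂μ ≤ ENNReal.ofReal L) :
    eLpNorm f (ENNReal.ofReal p) μ ≤ ENNReal.ofReal (M ^ (1 - 1 / p) * L ^ (1 / p)) := by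
  have hp0 : 0 < p := by linarith
  rw [eLpNorm_eq_lintegral_rpow_enorm_toReal (by simpa using hp0) ENNReal.ofReal_ne_top,
    ENNReal.toReal_ofReal hp0.le]
  have h : ∫⁻ x, ‖f x‖ₑ ^ p ∂μ ≤ ENNReal.ofReal (M ^ (p - 1) * L) := by
    rw [ENNReal.ofReal_mul (by positivity)]
    refine le_trans (lintegral_mono fun x => ?_)
      (le_trans (le_of_eq (lintegral_const_mul' _ _ ENNReal.ofReal_ne_top))
        (mul_le_mul_right hfL _))
    rw [← ENNReal.ofReal_rpow_of_pos hM]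
    calc ‖f x‖ₑ ^ p = ‖f x‖ₑ ^ (p - 1) * ‖f x‖ₑ := by
          conv_lhs => rw [← sub_add_cancel p 1]
          rw [ENNReal.rpow_add_of_nonneg _ _ (by linarith) zero_le_one, ENNReal.rpow_one]
      _ ≤ _ := by
          refine mul_le_mul_left (ENNReal.rpow_le_rpow ?_ (by linarith)) _
          rw [← ofReal_norm]
          exact ENNReal.ofReal_le_ofReal (hfM x)
  refine (ENNReal.rpow_le_rpow h (by positivity)).trans (le_of_eq ?_)
  rw [ENNReal.ofReal_rpow_of_nonneg (by positivity) (by positivity),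
    Real.mul_rpow (by positivity) hL, ← Real.rpow_mul hM.le]
  congr 3
  field_simp

end SignsAndHolder

/-! ### Wave packets and the test of the operator norm -/

section WavePackets

open MeasureTheory Set Complex

variable {d : ℕ}

/-- The free Schrödinger evolution of the function with frequency density `H`. -/
noncomputable def freeEvolution (H : EuclideanSpace ℝ (Fin d) → ℂ) (x : EuclideanSpace ℝ (Fin d))
    (t : ℝ) : ℂ :=
  oscIntegral (fun ξ => exp (-I * (t : ℂ) * ((‖ξ‖ ^ 2 : ℝ) : ℂ)) * H ξ) x

lemma norm_exp_neg_I_mul (t s : ℝ) : ‖exp (-I * (t : ℂ) * (s : ℂ))‖ = 1 := by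
  rw [show -I * (t : ℂ) * (s : ℂ) = ((-(t * s) : ℝ) : ℂ) * I by push_cast; ring]
  exact norm_exp_ofReal_mul_I _

lemma freeEvolution_zero (H : EuclideanSpace ℝ (Fin d) → ℂ) (x : EuclideanSpace ℝ (Fin d)) :
    freeEvolution H x 0 = oscIntegral H x := by
  simp [freeEvolution]

lemma integrable_freeEvolution_integrand {H : EuclideanSpace ℝ (Fin d) → ℂ} (hH : Integrable H)
    (x : EuclideanSpace ℝ (Fin d)) (t : ℝ) :
    Integrable fun ξ => exp (-I * (t : ℂ) * ((‖ξ‖ ^ 2 : ℝ) : ℂ)) * H ξ *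
      exp (I * ((inner ℝ x ξ : ℝ) : ℂ)) := by
  refine hH.mono ?_ ?_
  · exact ((Continuous.aestronglyMeasurable (by fun_prop)).mul hH.aestronglyMeasurable).mul
      (Continuous.aestronglyMeasurable (by fun_prop))
  · filter_upwards with ξ
    rw [norm_mul, norm_mul, norm_exp_neg_I_mul]
    simp

lemma continuous_freeEvolution {H : EuclideanSpace ℝ (Fin d) → ℂ} (hH : Integrable H) :
    Continuous (Function.uncurry (freeEvolution H)) := by
  refine continuous_of_dominated (bound := fun ξ => ‖H ξ‖) ?_ ?_ hH.norm ?_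
  · rintro ⟨x, t⟩
    exact (integrable_freeEvolution_integrand hH x t).aestronglyMeasurable
  · rintro ⟨x, t⟩
    filter_upwards with ξ
    rw [norm_mul, norm_mul, norm_exp_neg_I_mul]
    simp
  · filter_upwards with ξ
    fun_prop

lemma freeEvolution_sum {ι : Type*} (A : Finset ι) (b : ι → ℂ)
    {H : ι → EuclideanSpace ℝ (Fin d) → ℂ} (hH : ∀ i, Integrable (H i))
    (x : EuclideanSpace ℝ (Fin d)) (t : ℝ) :
    freeEvolution (fun ξ => ∑ i ∈ A, b i * H i ξ) x t =
      ∑ i ∈ A, b i * freeEvolution (H i) x t := by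
  simp only [freeEvolution, oscIntegral, ← integral_const_mul]
  rw [← integral_finsetSum _ fun i _ => (integrable_freeEvolution_integrand (hH i) x t).const_mul _]
  congr 1
  ext ξ
  rw [Finset.mul_sum, Finset.sum_mul]
  exact Finset.sum_congr rfl fun i _ => by ring

/-- Where `η` equals one on the rescaled frequency support, the localized evolution is the free
evolution. -/
lemma evolution_oscIntegral {η : EuclideanSpace ℝ (Fin d) → ℂ} (hη : ContDiff ℝ ∞ η)
    (hη_supp : HasCompactSupport η)
    (hη_one : ∀ ξ : EuclideanSpace ℝ (Fin d), 1 / 4 ≤ ‖ξ‖ → ‖ξ‖ ≤ 12 → η ξ = 1)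
    {lam : ℝ} (hlam : 0 < lam) {H : EuclideanSpace ℝ (Fin d) → ℂ} (hH : ContDiff ℝ ∞ H)
    (hH_supp : HasCompactSupport H)
    (hH_freq : ∀ ξ, H ξ ≠ 0 → lam / 4 ≤ ‖ξ‖ ∧ ‖ξ‖ ≤ 12 * lam)
    (x : EuclideanSpace ℝ (Fin d)) (t : ℝ) :
    evolution η lam (oscIntegral H) x t = freeEvolution H x t := by
  have hηc := hη.continuous
  have hm : Integrable (multiplier η lam t) := by
    refine Continuous.integrable_of_hasCompactSupport ?_ ?_
    · unfold multiplier
      fun_prop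
    · exact (hη_supp.comp_smul (inv_ne_zero hlam.ne')).mul_left
  have h := multiplierOp_oscIntegral hm (hH_supp.toSchwartzMap hH) x
  rw [show ⇑(hH_supp.toSchwartzMap hH) = H from rfl] at h
  rw [evolution, h, freeEvolution]
  congr 1
  ext ξ
  by_cases h0 : H ξ = 0
  · rw [h0, mul_zero, mul_zero]
  · obtain ⟨h1, h2⟩ := hH_freq ξ h0
    have hn : ‖lam⁻¹ • ξ‖ = ‖ξ‖ / lam := by
      rw [norm_smul, Real.norm_of_nonneg (by positivity)]
      ring
    rw [multiplier, hη_one, mul_one]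
    · rw [hn, le_div_iff₀ hlam]; linarith
    · rw [hn, div_le_iff₀ hlam]; linarith

/-- The frequency density of the wave packet at position `a • e` with velocity `2 v • e`. -/
noncomputable def packetSymbol (h : EuclideanSpace ℝ (Fin d) → ℂ) (e : EuclideanSpace ℝ (Fin d))
    (a v : ℝ) (ξ : EuclideanSpace ℝ (Fin d)) : ℂ :=
  exp (-I * ((a * inner ℝ e ξ : ℝ) : ℂ)) * h (ξ - v • e)

lemma contDiff_packetSymbol {h : EuclideanSpace ℝ (Fin d) → ℂ} (hh : ContDiff ℝ ∞ h)
    (e : EuclideanSpace ℝ (Fin d)) (a v : ℝ) : ContDiff ℝ ∞ (packetSymbol h e a v) := by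
  have h1 : ContDiff ℝ ∞ fun ξ : EuclideanSpace ℝ (Fin d) => ((a * inner ℝ e ξ : ℝ) : ℂ) :=
    ofRealCLM.contDiff.comp (contDiff_const.mul (contDiff_const.inner ℝ contDiff_id))
  exact (contDiff_const.mul h1).cexp.mul (hh.comp (contDiff_id.sub contDiff_const))

lemma hasCompactSupport_packetSymbol {h : EuclideanSpace ℝ (Fin d) → ℂ}
    (hh : HasCompactSupport h) (e : EuclideanSpace ℝ (Fin d)) (a v : ℝ) :
    HasCompactSupport (packetSymbol h e a v) :=
  (hh.comp_homeomorph (Homeomorph.subRight (v • e))).mul_left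

/-- Galilean invariance: the packet moves along the line `a + 2 t v`. -/
lemma norm_freeEvolution_packetSymbol (h : EuclideanSpace ℝ (Fin d) → ℂ)
    {e : EuclideanSpace ℝ (Fin d)} (he : ‖e‖ = 1) (a v : ℝ) (x : EuclideanSpace ℝ (Fin d))
    (t : ℝ) :
    ‖freeEvolution (packetSymbol h e a v) x t‖ =
      ‖freeEvolution h (x - (a + 2 * t * v) • e) t‖ := by
  -- Substitute ξ = ζ + v e. The cross term 2tv⟨e,ζ⟩ of the quadratic phase joins a⟨e,ζ⟩ as a
  -- translation; what does not depend on ζ is a unimodular factor.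
  have key : freeEvolution (packetSymbol h e a v) x t =
      exp (((v * inner ℝ x e - a * v - t * v ^ 2 : ℝ) : ℂ) * I) *
        freeEvolution h (x - (a + 2 * t * v) • e) t := by
    rw [freeEvolution, oscIntegral, ← integral_add_right_eq_self _ (v • e), freeEvolution,
      oscIntegral, ← integral_const_mul]
    congr 1
    ext ζ
    rw [packetSymbol, add_sub_cancel_right]
    have hn : ‖ζ + v • e‖ ^ 2 = ‖ζ‖ ^ 2 + 2 * v * inner ℝ e ζ + v ^ 2 := by
      rw [norm_add_sq_real, norm_smul, he, real_inner_smul_right, real_inner_comm,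
        Real.norm_eq_abs, mul_one, sq_abs]
      ring
    have hi : inner ℝ e (ζ + v • e) = inner ℝ e ζ + v := by
      rw [inner_add_right, real_inner_smul_right, real_inner_self_eq_norm_sq, he]
      ring
    have hx : inner ℝ x (ζ + v • e) = inner ℝ x ζ + v * inner ℝ x e := by
      rw [inner_add_right, real_inner_smul_right]
    have hy : inner ℝ (x - (a + 2 * t * v) • e) ζ =
        inner ℝ x ζ - (a + 2 * t * v) * inner ℝ e ζ := by
      rw [inner_sub_left, real_inner_smul_left]
    rw [hn, hi, hx, hy]
    have hexp : ∀ A B C D E F w : ℂ, A + B + C = D + E + F →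
        exp A * (exp B * w) * exp C = exp D * (exp E * w * exp F) := by
      intro A B C D E F w hABC
      calc exp A * (exp B * w) * exp C = exp (A + B + C) * w := by
            rw [exp_add, exp_add]; ring
        _ = _ := by rw [hABC, exp_add, exp_add]; ring
    apply hexp
    push_cast
    ring
  rw [key, norm_mul, norm_exp_ofReal_mul_I, one_mul]

/-- The evolution of a nonnegative density near the origin does not cancel on the unit scale. -/
lemma half_integral_le_norm_freeEvolution {φ : EuclideanSpace ℝ (Fin d) → ℝ}
    (hφ : Integrable φ) (hφ0 : ∀ ξ, 0 ≤ φ ξ) (hφs : ∀ ξ, φ ξ ≠ 0 → ‖ξ‖ ≤ 1 / 2)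
    {x : EuclideanSpace ℝ (Fin d)} (hx : ‖x‖ ≤ 1) {t : ℝ} (ht0 : 0 ≤ t) (ht1 : t ≤ 1) :
    (∫ ξ, φ ξ) / 2 ≤ ‖freeEvolution (fun ξ => (φ ξ : ℂ)) x t‖ := by
  refine le_trans ?_ (re_le_norm _)
  have hφc : Integrable fun ξ => (φ ξ : ℂ) := hφ.ofReal
  have hint := integrable_freeEvolution_integrand hφc x t
  rw [freeEvolution, oscIntegral, ← RCLike.re_eq_complex_re, ← integral_re hint,
    ← integral_div]
  refine integral_mono (hφ.div_const 2) hint.re fun ξ => ?_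
  have hre : RCLike.re (exp (-I * (t : ℂ) * ((‖ξ‖ ^ 2 : ℝ) : ℂ)) * (φ ξ : ℂ) *
      exp (I * ((inner ℝ x ξ : ℝ) : ℂ))) = φ ξ * Real.cos (inner ℝ x ξ - t * ‖ξ‖ ^ 2) := by
    have : exp (-I * (t : ℂ) * ((‖ξ‖ ^ 2 : ℝ) : ℂ)) * (φ ξ : ℂ) *
        exp (I * ((inner ℝ x ξ : ℝ) : ℂ)) =
        (φ ξ : ℂ) * exp (((inner ℝ x ξ - t * ‖ξ‖ ^ 2 : ℝ) : ℂ) * I) := by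
      rw [mul_comm (exp _) (φ ξ : ℂ), mul_assoc, ← exp_add]
      congr 2
      push_cast
      ring
    rw [this, RCLike.re_eq_complex_re, re_ofReal_mul, exp_ofReal_mul_I_re]
  refine le_of_le_of_eq ?_ hre.symm
  by_cases h0 : φ ξ = 0
  · simp [h0]
  have hξ := hφs ξ h0
  have hin := abs_le.1 ((abs_real_inner_le_norm x ξ).trans
    (mul_le_mul hx hξ (norm_nonneg _) zero_le_one))
  have hsq : ‖ξ‖ ^ 2 ≤ 1 / 4 := by nlinarith [norm_nonneg ξ]
  have hsq0 : 0 ≤ t * ‖ξ‖ ^ 2 := by positivity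
  have hsq1 : t * ‖ξ‖ ^ 2 ≤ 1 / 4 := by nlinarith [sq_nonneg ‖ξ‖]
  -- The phase has modulus at most 3/4, so its cosine is at least 1/2.
  have hcos := Real.one_sub_sq_div_two_le_cos (x := inner ℝ x ξ - t * ‖ξ‖ ^ 2)
  have hs : (inner ℝ x ξ - t * ‖ξ‖ ^ 2) ^ 2 ≤ 1 := by
    rw [sq_le_one_iff_abs_le_one]
    exact abs_le.2 ⟨by linarith [hin.1], by linarith [hin.2]⟩
  have := mul_le_mul_of_nonneg_left (show 1 / 2 ≤ Real.cos (inner ℝ x ξ - t * ‖ξ‖ ^ 2) by linarith)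
    (hφ0 ξ)
  linarith

/-- A sum of signed, separated wave packets has bounded sup norm and controlled `L¹` norm. -/
lemma exists_packet_sum_bounds {h : EuclideanSpace ℝ (Fin d) → ℂ} (hh : ContDiff ℝ ∞ h)
    (hhs : HasCompactSupport h) :
    ∃ M Λ : ℝ, 0 < M ∧ 0 < Λ ∧ ∀ e : EuclideanSpace ℝ (Fin d), ‖e‖ = 1 →
      ∀ {ι : Type} (A : Finset ι) (a v : ι → ℝ) (ε : ι → ℝ),
      (∀ i ∈ A, ∀ j ∈ A, i ≠ j → 1 ≤ |a i - a j|) → (∀ i, |ε i| = 1) →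
      (∀ x, ‖oscIntegral (fun ξ => ∑ i ∈ A, (ε i : ℂ) * packetSymbol h e (a i) (v i) ξ) x‖ ≤ M) ∧
      ∫⁻ x, ‖oscIntegral (fun ξ => ∑ i ∈ A, (ε i : ℂ) * packetSymbol h e (a i) (v i) ξ) x‖ₑ ≤
        ENNReal.ofReal (A.card * Λ) := by
  obtain ⟨K, hK, hsum⟩ := exists_sum_separated_le
  obtain ⟨C, hC, hdecay⟩ := exists_decay_oscIntegral (hhs.toSchwartzMap hh)
  have hgint := integrable_oscIntegral (hhs.toSchwartzMap hh)
  rw [show ⇑(hhs.toSchwartzMap hh) = h from rfl] at hdecay hgint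
  -- The added 1 only keeps Λ positive when h vanishes.
  refine ⟨C * K, (∫ x, ‖oscIntegral h x‖) + 1, by positivity, by positivity, ?_⟩
  intro e he ι A a v ε hsep hε
  have hpint : ∀ i, Integrable (packetSymbol h e (a i) (v i)) := fun i =>
    (contDiff_packetSymbol hh e _ _).continuous.integrable_of_hasCompactSupport
      (hasCompactSupport_packetSymbol hhs e _ _)
  have hle : ∀ x, ‖oscIntegral (fun ξ => ∑ i ∈ A, (ε i : ℂ) * packetSymbol h e (a i) (v i) ξ) x‖ ≤
      ∑ i ∈ A, ‖oscIntegral h (x - a i • e)‖ := by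
    intro x
    -- At time 0 Galilean invariance makes each packet, in modulus, a translate of `oscIntegral h`;
    -- the velocities play no role.
    rw [← freeEvolution_zero, freeEvolution_sum A _ hpint]
    refine (norm_sum_le _ _).trans (le_of_eq (Finset.sum_congr rfl fun i _ => ?_))
    rw [norm_mul, norm_freeEvolution_packetSymbol h he, norm_real, Real.norm_eq_abs, hε, one_mul,
      freeEvolution_zero, mul_zero, zero_mul, add_zero]
  constructor
  · intro x
    refine (hle x).trans ?_
    calc ∑ i ∈ A, ‖oscIntegral h (x - a i • e)‖
        ≤ ∑ i ∈ A, C * (1 / (1 + (inner ℝ x e - a i) ^ 2)) := by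
          refine Finset.sum_le_sum fun i _ => (hdecay _).trans ?_
          rw [mul_one_div]
          have hin := abs_real_inner_le_norm (x - a i • e) e
          rw [he, mul_one, inner_sub_left, real_inner_smul_left, real_inner_self_eq_norm_sq, he,
            one_pow, mul_one] at hin
          have := sq_le_sq' (by linarith [neg_abs_le (inner ℝ x e - a i)])
            ((le_abs_self _).trans hin)
          gcongr
      _ ≤ C * K := by
          rw [← Finset.mul_sum]
          exact mul_le_mul_of_nonneg_left (hsum A a hsep _) hC.le
  · have hnorm : ∫⁻ x, ‖oscIntegral h x‖ₑ = ENNReal.ofReal (∫ x, ‖oscIntegral h x‖) :=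
      (ofReal_integral_norm_eq_lintegral_enorm hgint).symm
    have hcont : Continuous (oscIntegral h) :=
      continuous_oscIntegral (hh.continuous.integrable_of_hasCompactSupport hhs)
    calc _ ≤ ∫⁻ x, ∑ i ∈ A, ‖oscIntegral h (x - a i • e)‖ₑ := by
          refine lintegral_mono fun x => ?_
          simp only [← ofReal_norm]
          rw [← ENNReal.ofReal_sum_of_nonneg fun i _ => norm_nonneg _]
          exact ENNReal.ofReal_le_ofReal (hle x)
      _ = ∑ i ∈ A, ∫⁻ x, ‖oscIntegral h x‖ₑ := by
          have hm : ∀ i, Measurable fun x => ‖oscIntegral h (x - a i • e)‖ₑ := fun i =>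
            (hcont.comp (continuous_sub_right (a i • e))).measurable.enorm
          rw [lintegral_finsetSum _ fun i _ => hm i]
          exact Finset.sum_congr rfl fun i _ =>
            lintegral_sub_right_eq_self (fun x => ‖oscIntegral h x‖ₑ) _
      _ ≤ _ := by
          rw [Finset.sum_const, nsmul_eq_mul, hnorm, ENNReal.ofReal_mul (by positivity),
            ENNReal.ofReal_natCast]
          gcongr
          linarith

lemma mul_oscIntegral (c : ℂ) (H : EuclideanSpace ℝ (Fin d) → ℂ) (x : EuclideanSpace ℝ (Fin d)) :
    oscIntegral (fun ξ => c * H ξ) x = c * oscIntegral H x := by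
  simp only [oscIntegral, ← integral_const_mul, mul_assoc]

/-- Testing the operator norm on a smooth frequency density supported where the cutoff is one. -/
lemma setLIntegral_freeEvolution_le_localizedNorm {η : EuclideanSpace ℝ (Fin d) → ℂ}
    (hη : ContDiff ℝ ∞ η) (hη_supp : HasCompactSupport η)
    (hη_one : ∀ ξ : EuclideanSpace ℝ (Fin d), 1 / 4 ≤ ‖ξ‖ → ‖ξ‖ ≤ 12 → η ξ = 1)
    {p q r lam : ℝ} (hq : 2 ≤ q) (hr : 2 ≤ r) (hlam : 0 < lam)
    {H : EuclideanSpace ℝ (Fin d) → ℂ} (hH : ContDiff ℝ ∞ H) (hH_supp : HasCompactSupport H)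
    (hH_freq : ∀ ξ, H ξ ≠ 0 → lam / 4 ≤ ‖ξ‖ ∧ ‖ξ‖ ≤ 12 * lam)
    {a : ℝ} (ha : 0 < a)
    (hnorm : eLpNorm (oscIntegral H) (ENNReal.ofReal p) volume ≤ ENNReal.ofReal a)
    {W : Set (EuclideanSpace ℝ (Fin d) × ℝ)} (hW : MeasurableSet W)
    {X : Set (EuclideanSpace ℝ (Fin d))}
    (hWX : ∀ z ∈ W, z.2 ∈ Icc (1 / 2 : ℝ) 1 ∧ z.1 ∈ X) {α β : ℝ≥0∞}
    (hα : ∀ x, volume {t | (x, t) ∈ W} ≤ α) (hβ : volume X ≤ β) :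
    (∫⁻ z in W, ‖freeEvolution H z.1 z.2‖ₑ ^ 2) ^ (1 / 2 : ℝ) ≤
      localizedNorm η p q r lam * ENNReal.ofReal a * α ^ (1 / 2 - 1 / r) *
        β ^ (1 / 2 - 1 / q) := by
  have hHint : Integrable H := hH.continuous.integrable_of_hasCompactSupport hH_supp
  set b : ℂ := ((a⁻¹ : ℝ) : ℂ) with hb
  have hb0 : b ≠ 0 := by rw [hb]; exact_mod_cast (inv_pos.2 ha).ne'
  have hbnorm : ‖b‖ₑ = ENNReal.ofReal a⁻¹ := by
    rw [← ofReal_norm, hb, norm_real, Real.norm_of_nonneg (inv_pos.2 ha).le]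
  have hfun : oscIntegral (fun ξ => b * H ξ) = b • oscIntegral H := by
    ext x; exact mul_oscIntegral b H x
  have hle1 : eLpNorm (oscIntegral fun ξ => b * H ξ) (ENNReal.ofReal p) volume ≤ 1 := by
    rw [hfun, eLpNorm_const_smul, hbnorm]
    refine (mul_le_mul_right hnorm _).trans (le_of_eq ?_)
    rw [← ENNReal.ofReal_mul (inv_pos.2 ha).le, inv_mul_cancel₀ ha.ne', ENNReal.ofReal_one]
  have hmem : MemLp (oscIntegral fun ξ => b * H ξ) (ENNReal.ofReal p) volume :=
    ⟨(continuous_oscIntegral (hHint.const_mul b)).aestronglyMeasurable,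
      hle1.trans_lt ENNReal.one_lt_top⟩
  have hev : evolution η lam (oscIntegral fun ξ => b * H ξ) =
      freeEvolution fun ξ => b * H ξ := by
    ext x t
    exact evolution_oscIntegral hη hη_supp hη_one hlam (contDiff_const.mul hH)
      hH_supp.mul_left (fun ξ hξ => hH_freq ξ (right_ne_zero_of_mul hξ)) x t
  have hnormle : mixedNorm q r (freeEvolution fun ξ => b * H ξ) ≤ localizedNorm η p q r lam := by
    rw [← hev]
    exact le_iSup_of_le _ (le_iSup_of_le hmem (le_iSup_of_le hle1 le_rfl))
  have hhold := setLIntegral_sq_le_mixedNorm hq hr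
    (continuous_freeEvolution (hHint.const_mul b)).measurable hW hWX hα hβ
  have hscale (x : EuclideanSpace ℝ (Fin d)) (t : ℝ) :
      freeEvolution H x t = (a : ℂ) * freeEvolution (fun ξ => b * H ξ) x t := by
    rw [freeEvolution, freeEvolution, ← mul_oscIntegral]
    congr 1
    ext ξ
    rw [hb]
    push_cast
    have : (a : ℂ) ≠ 0 := by exact_mod_cast ha.ne'
    field_simp
  have hanorm : ‖(a : ℂ)‖ₑ = ENNReal.ofReal a := by
    rw [← ofReal_norm, norm_real, Real.norm_of_nonneg ha.le]
  calc (∫⁻ z in W, ‖freeEvolution H z.1 z.2‖ₑ ^ 2) ^ (1 / 2 : ℝ)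
      = ENNReal.ofReal a *
          (∫⁻ z in W, ‖freeEvolution (fun ξ => b * H ξ) z.1 z.2‖ₑ ^ 2) ^ (1 / 2 : ℝ) := by
        simp only [hscale, enorm_mul, mul_pow, hanorm]
        rw [lintegral_const_mul' _ _ (ENNReal.pow_ne_top ENNReal.ofReal_ne_top),
          ENNReal.mul_rpow_of_nonneg _ _ (by norm_num), ← ENNReal.rpow_natCast,
          ← ENNReal.rpow_mul]
        norm_num
    _ ≤ ENNReal.ofReal a * (localizedNorm η p q r lam * α ^ (1 / 2 - 1 / r) *
          β ^ (1 / 2 - 1 / q)) := by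
        refine mul_le_mul_right (hhold.trans ?_) _
        gcongr
    _ = _ := by ring

/-- The final bookkeeping: κ N^{1/2} is the L² lower bound on W, and the last bracket is the L^p
bound of the datum times the two Hölder factors. Nonnegativity of 1/2 - 1/p and 1/2 - 1/r lets N and
n be replaced by λ/2 and (log λ)/2. -/
lemma rpow_log_lower_bound {p q r M Λ κ A B N n lam : ℝ} (hp : 2 ≤ p)
    (hr : 2 ≤ r) (hM : 0 < M) (hΛ : 0 < Λ) (hκ : 0 < κ) (hA : 0 < A) (hB : 0 < B)
    (hlam : 2 ≤ lam) (hN : lam / 2 ≤ N) (hn : Real.log lam / 2 ≤ n) :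
    κ / (M ^ (1 - 1 / p) * Λ ^ (1 / p) * A ^ (1 / 2 - 1 / r) * B ^ (1 / 2 - 1 / q) *
        2 ^ (1 / 2 - 1 / p) * 2 ^ (1 / 2 - 1 / r)) *
        lam ^ (1 / q - 1 / p) * (Real.log lam) ^ (1 / 2 - 1 / r) *
      (M ^ (1 - 1 / p) * (N * Λ) ^ (1 / p) * (A / n) ^ (1 / 2 - 1 / r) *
        (B * lam) ^ (1 / 2 - 1 / q)) ≤ κ * N ^ (1 / 2 : ℝ) := by
  have hlam0 : 0 < lam := by linarith
  have hlog : 0 < Real.log lam := Real.log_pos (by linarith)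
  have hN0 : 0 < N := by linarith
  have hn0 : 0 < n := by linarith
  have hρ : 0 ≤ 1 / 2 - 1 / r := by
    rw [sub_nonneg]; exact one_div_le_one_div_of_le two_pos hr
  have hσ : 0 ≤ 1 / 2 - 1 / p := by
    rw [sub_nonneg]; exact one_div_le_one_div_of_le two_pos hp
  rw [Real.mul_rpow hN0.le hΛ.le, Real.div_rpow hA.le hn0.le, Real.mul_rpow hB.le hlam0.le]
  have h1 : lam ^ (1 / q - 1 / p) * lam ^ (1 / 2 - 1 / q) = lam ^ (1 / 2 - 1 / p) := by
    rw [← Real.rpow_add hlam0]; congr 1; ring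
  have h2 : N ^ (1 / 2 - 1 / p) * N ^ (1 / p) = N ^ (1 / 2 : ℝ) := by
    rw [← Real.rpow_add hN0]; congr 1; ring
  have h3 : lam ^ (1 / 2 - 1 / p) / 2 ^ (1 / 2 - 1 / p) ≤ N ^ (1 / 2 - 1 / p) := by
    rw [← Real.div_rpow hlam0.le two_pos.le]
    exact Real.rpow_le_rpow (by positivity) hN hσ
  have h4 : Real.log lam ^ (1 / 2 - 1 / r) / 2 ^ (1 / 2 - 1 / r) / n ^ (1 / 2 - 1 / r) ≤ 1 := by
    rw [← Real.div_rpow hlog.le two_pos.le]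
    exact div_le_one_of_le₀ (Real.rpow_le_rpow (by positivity) hn hρ) (by positivity)
  calc _ = κ * ((lam ^ (1 / q - 1 / p) * lam ^ (1 / 2 - 1 / q)) / 2 ^ (1 / 2 - 1 / p) *
        N ^ (1 / p)) *
        (Real.log lam ^ (1 / 2 - 1 / r) / 2 ^ (1 / 2 - 1 / r) / n ^ (1 / 2 - 1 / r)) := by
        field_simp
    _ ≤ κ * (N ^ (1 / 2 - 1 / p) * N ^ (1 / p)) * 1 := by
        rw [h1]
        gcongr
    _ = _ := by rw [h2, mul_one]

lemma exists_two_pow_le {lam : ℝ} (hlam : 2 ≤ lam) :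
    ∃ n : ℕ, 1 ≤ n ∧ (2 : ℝ) ^ n ≤ lam ∧ lam / 2 ≤ 2 ^ n ∧ Real.log lam / 2 ≤ n := by
  obtain ⟨n, h1, h2⟩ := exists_nat_pow_near (x := lam) (y := 2) (by linarith) one_lt_two
  have hn : 1 ≤ n := by
    by_contra h
    have : n = 0 := by omega
    subst this
    norm_num at h2
    linarith
  refine ⟨n, hn, h1, by rw [pow_succ] at h2; linarith, ?_⟩
  have hlog : Real.log lam ≤ (n + 1 : ℕ) * Real.log 2 := by
    rw [← Real.log_pow]
    exact Real.log_le_log (by linarith) h2.le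
  have hn' : (1 : ℝ) ≤ n := by exact_mod_cast hn
  push_cast at hlog
  nlinarith [Real.log_two_lt_d9, Real.log_two_gt_d9]

end WavePackets

end SchrodingerLocalized

/-! ### The lower bound for the localized norm -/

open SchrodingerLocalized MeasureTheory Set in
theorem proposition3p1 (d : ℕ) (hd : 1 ≤ d) (p q r : ℝ) (hp : 2 ≤ p) (hq : 2 ≤ q) (hr : 2 ≤ r)
    (η : EuclideanSpace ℝ (Fin d) → ℂ) (hη_smooth : ContDiff ℝ ∞ η)
    (hη_supp : HasCompactSupport η)
    (hη_radial : ∀ ξ ζ : EuclideanSpace ℝ (Fin d), ‖ξ‖ = ‖ζ‖ → η ξ = η ζ)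
    (hη_one : ∀ ξ : EuclideanSpace ℝ (Fin d), 1 / 4 ≤ ‖ξ‖ → ‖ξ‖ ≤ 12 → η ξ = 1) :
    ∃ c : ℝ, 0 < c ∧ ∃ lam₀ : ℝ, 1 < lam₀ ∧ ∀ lam : ℝ, lam₀ ≤ lam →
      ENNReal.ofReal
          (c * lam ^ (1 / q - 1 / p) * (Real.log lam) ^ (1 / 2 - 1 / r)) ≤
        SchrodingerLocalized.localizedNorm η p q r lam := by
  obtain ⟨e, he⟩ : ∃ e : EuclideanSpace ℝ (Fin d), ‖e‖ = 1 :=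
    ⟨EuclideanSpace.single ⟨0, hd⟩ 1, by simp⟩
  let φ : ContDiffBump (0 : EuclideanSpace ℝ (Fin d)) := ⟨1 / 4, 1 / 2, by norm_num, by norm_num⟩
  have hφs : ∀ ξ, φ ξ ≠ 0 → ‖ξ‖ ≤ 1 / 2 := by
    intro ξ hξ
    have : ξ ∈ Metric.ball (0 : EuclideanSpace ℝ (Fin d)) (1 / 2) := φ.support_eq ▸ hξ
    exact (mem_ball_zero_iff.1 this).le
  set h : EuclideanSpace ℝ (Fin d) → ℂ := fun ξ => (φ ξ : ℂ) with hh
  have hh_smooth : ContDiff ℝ ∞ h := Complex.ofRealCLM.contDiff.comp φ.contDiff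
  have hh_supp : HasCompactSupport h := φ.hasCompactSupport.comp_left Complex.ofReal_zero
  set c₀ : ℝ := (∫ ξ, φ ξ) / 2 with hc₀
  have hc₀pos : 0 < c₀ := half_pos φ.integral_pos
  obtain ⟨M, Λ, hM, hΛ, hbounds⟩ := exists_packet_sum_bounds hh_smooth hh_supp
  set v₁ := volume (Metric.closedBall (0 : EuclideanSpace ℝ (Fin d)) 1) with hv₁
  have hv₁top : v₁ ≠ ⊤ := measure_closedBall_lt_top.ne
  have hv₁pos : 0 < v₁.toReal :=
    ENNReal.toReal_pos (Metric.measure_closedBall_pos volume _ one_pos).ne' hv₁top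
  have hv₁eq : v₁ = ENNReal.ofReal v₁.toReal := (ENNReal.ofReal_toReal hv₁top).symm
  set κ : ℝ := c₀ * (v₁.toReal / 8) ^ (1 / 2 : ℝ) with hκ
  have hκpos : 0 < κ := by positivity
  set A : ℝ := 20 * 2 ^ d with hA
  have hApos : 0 < A := by positivity
  -- The factor 11 comes from 2 · 5λ + 1 ≤ 11λ, the length of the segment over which W lies.
  set B : ℝ := 11 * 2 ^ d * v₁.toReal with hB
  have hBpos : 0 < B := by positivity
  refine ⟨κ / (M ^ (1 - 1 / p) * Λ ^ (1 / p) * A ^ (1 / 2 - 1 / r) * B ^ (1 / 2 - 1 / q) *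
        2 ^ (1 / 2 - 1 / p) * 2 ^ (1 / 2 - 1 / r)), by positivity, 2, one_lt_two,
        fun lam hlam => ?_⟩
  have hlam0 : 0 < lam := by linarith
  obtain ⟨n, hn, hn1, hn2, hn3⟩ := exists_two_pow_le hlam
  have hn0 : (0 : ℝ) < n := by exact_mod_cast hn
  obtain ⟨W, hWm, hWX, hWα, hWmass⟩ := exists_compressed_set he hn hn1
  set a : Finset ℕ → ℝ := fun S => linePosition n S 2
  set v : Finset ℕ → ℝ := fun S => 2 * lam - lineSlope n S with hv
  set 𝒮 := (Finset.range n).powerset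
  have hcard : (𝒮.card : ℝ) = 2 ^ n := by simp [𝒮]
  have hPint : ∀ S, Integrable (packetSymbol h e (a S) (v S)) := fun S =>
    (contDiff_packetSymbol hh_smooth e _ _).continuous.integrable_of_hasCompactSupport
      (hasCompactSupport_packetSymbol hh_supp e _ _)
  obtain ⟨ε, hε, hsigns⟩ := exists_signs_lintegral_sq_ge (volume.restrict W) 𝒮
    (F := fun S z => freeEvolution (packetSymbol h e (a S) (v S)) z.1 z.2)
    fun S => (continuous_freeEvolution (hPint S)).measurable
  set H : EuclideanSpace ℝ (Fin d) → ℂ :=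
    fun ξ => ∑ S ∈ 𝒮, (ε S : ℂ) * packetSymbol h e (a S) (v S) ξ with hH
  obtain ⟨hsup, hL1⟩ := hbounds e he 𝒮 a v ε
    (fun S hS T hT hne => linePosition_two_separated (Finset.mem_powerset.1 hS)
      (Finset.mem_powerset.1 hT) hne) hε
  rw [hcard] at hL1
  have hH_smooth : ContDiff ℝ ∞ H :=
    ContDiff.sum fun S _ => contDiff_const.mul (contDiff_packetSymbol hh_smooth e _ _)
  -- Slopes lie in [0, 2^n] and 2^n ≤ λ, so every packet frequency is within 1/2 of a vector of
  -- length in [λ, 2λ], where the cutoff equals 1.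
  have hH_freq : ∀ ξ, H ξ ≠ 0 → lam / 4 ≤ ‖ξ‖ ∧ ‖ξ‖ ≤ 12 * lam := by
    intro ξ hξ
    obtain ⟨S, hS, hne⟩ := Finset.exists_ne_zero_of_sum_ne_zero hξ
    have h1 : ‖ξ - v S • e‖ ≤ 1 / 2 := by
      refine hφs _ fun h0 => right_ne_zero_of_mul (right_ne_zero_of_mul hne) ?_
      simp only [hh, h0, Complex.ofReal_zero]
    have hv1 : lam ≤ v S := by
      have := lineSlope_le (Finset.mem_powerset.1 hS)
      simp only [hv]; linarith
    have hv2 : v S ≤ 2 * lam := by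
      have := lineSlope_nonneg n S
      simp only [hv]; linarith
    have hve : ‖v S • e‖ = v S := by
      rw [norm_smul, he, mul_one, Real.norm_of_nonneg (by linarith)]
    have h2 := norm_sub_norm_le ξ (v S • e)
    have h3 := norm_sub_norm_le (v S • e) ξ
    rw [norm_sub_rev] at h3
    rw [hve] at h2 h3
    constructor <;> linarith
  have hH_supp : HasCompactSupport H := by
    refine HasCompactSupport.of_support_subset_isCompact
      (isCompact_closedBall (0 : EuclideanSpace ℝ (Fin d)) (12 * lam)) fun ξ hξ => ?_
    exact mem_closedBall_zero_iff.2 (hH_freq ξ hξ).2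
  have hnorm := eLpNorm_le_of_bound_of_lintegral (p := p) (by linarith) hM
    (by positivity) hsup hL1
  have hX : volume (segmentNhd e 0 (5 * lam)) ≤ ENNReal.ofReal (B * lam) := by
    refine (volume_segmentNhd_le he 0 (by positivity)).trans ?_
    rw [← hv₁, hv₁eq, ← ENNReal.ofReal_mul (by positivity)]
    refine ENNReal.ofReal_le_ofReal ?_
    have : (2 * (5 * lam) + 1) * (2 ^ d * v₁.toReal) ≤ 11 * lam * (2 ^ d * v₁.toReal) := by
      gcongr
      linarith
    rw [hB]
    linarith
  have hupper := setLIntegral_freeEvolution_le_localizedNorm hη_smooth hη_supp hη_one hq hr hlam0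
    hH_smooth hH_supp hH_freq (by positivity) hnorm hWm
    (fun z hz => ⟨⟨by linarith [(hWX z hz).1.1], (hWX z hz).1.2⟩, (hWX z hz).2⟩) hWα hX
  have hlower : ENNReal.ofReal (κ * (2 ^ n) ^ (1 / 2 : ℝ)) ≤
      (∫⁻ z in W, ‖freeEvolution H z.1 z.2‖ₑ ^ 2) ^ (1 / 2 : ℝ) := by
    have hpacket : ∀ S ∈ 𝒮, ENNReal.ofReal (c₀ ^ 2) * volume (W ∩ packetTube e n lam S) ≤
        ∫⁻ z in W, ‖freeEvolution (packetSymbol h e (a S) (v S)) z.1 z.2‖ₑ ^ 2 := by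
      intro S _
      rw [← setLIntegral_const]
      refine le_trans (setLIntegral_mono' (hWm.inter (measurableSet_packetTube e n lam S))
        fun z hz => ?_) (lintegral_mono_set inter_subset_left)
      rw [ENNReal.ofReal_pow hc₀pos.le, ← ofReal_norm, norm_freeEvolution_packetSymbol h he]
      gcongr
      have hzt := hz.2.1
      exact half_integral_le_norm_freeEvolution φ.integrable (fun _ => φ.nonneg) hφs hz.2.2
        (by linarith [hzt.1]) hzt.2
    have hint : ENNReal.ofReal (c₀ ^ 2 * (2 ^ n / 8 * v₁.toReal)) ≤
        ∫⁻ z in W, ‖freeEvolution H z.1 z.2‖ₑ ^ 2 := by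
      simp only [hH, freeEvolution_sum 𝒮 _ hPint]
      refine le_trans ?_ hsigns
      refine le_trans ?_ (Finset.sum_le_sum hpacket)
      rw [← Finset.mul_sum, ENNReal.ofReal_mul (by positivity),
        ENNReal.ofReal_mul (by positivity), ← hv₁eq]
      exact mul_le_mul_right hWmass _
    refine le_trans (le_of_eq ?_) (ENNReal.rpow_le_rpow hint (by norm_num))
    rw [ENNReal.ofReal_rpow_of_nonneg (by positivity) (by norm_num)]
    congr 1
    rw [show c₀ ^ 2 * (2 ^ n / 8 * v₁.toReal) = c₀ ^ 2 * ((v₁.toReal / 8) * 2 ^ n) by ring,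
      Real.mul_rpow (by positivity) (by positivity), Real.mul_rpow (by positivity) (by positivity),
      ← Real.sqrt_eq_rpow (c₀ ^ 2), Real.sqrt_sq hc₀pos.le, hκ, mul_assoc]
  have harith := rpow_log_lower_bound (q := q) (N := 2 ^ n) hp hr hM hΛ hκpos hApos hBpos hlam hn2 hn3
  have hchain := (ENNReal.ofReal_le_ofReal harith).trans (hlower.trans hupper)
  have hlog : 0 < Real.log lam := Real.log_pos (by linarith)
  -- The norm of the datum and the Hölder factors now form the same positive finite number on both
  -- sides, and cancel.
  rw [ENNReal.ofReal_rpow_of_pos (by positivity), ENNReal.ofReal_rpow_of_pos (by positivity),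
    mul_assoc (localizedNorm η p q r lam), ← ENNReal.ofReal_mul (by positivity),
    mul_assoc (localizedNorm η p q r lam), ← ENNReal.ofReal_mul (by positivity),
    ENNReal.ofReal_mul (by positivity)] at hchain
  refine (ENNReal.mul_le_mul_iff_left ?_ ENNReal.ofReal_ne_top).1 hchain
  rw [Ne, ENNReal.ofReal_eq_zero, not_le]
  positivity
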